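/- Let $P,Q:\mathbb R^2\to\mathbb R$ be radial $C^1$ functions, $P(x)=P(|x|)$, $Q(x)=Q(|x|)$, such that $P,Q$ and the radial derivatives $P',Q'$ are bounded. Let $w(x)=\sqrt2/\cosh x$, the unique positive even solution in $H^1(\mathbb R)$ of $-w''+w=w^3$. Consider sequences $\lambda_n\to+\infty$, $r_n\ge 0$, $\alpha_n,\gamma_n>0$ and $$\beta_n\in(-\sqrt{\alpha_n\gamma_n},0)\cup(0,\min\{\alpha_n,\gamma_n\})\cup(\max\{\alpha_n,\gamma_n\},+\infty).$$ Below the index $n$ is dropped, $r_\lambda$ stands for $r_n$, and $o(1)$ refers to $n\to\infty$. For radial profiles $f,g$ put $$\|(f,g)\|_\lambda^2=\int_0^\infty r\big(|f'|^2+(\lambda+P(r))f^2\big)dr+\int_0^\infty r\big(|g'|^2+(\lambda+Q(r))g^2\big)dr ,$$ and let $$U=\sqrt{\tfrac{\gamma-\beta}{\alpha\gamma-\beta^2}}\,w,\qquad V=\sqrt{\tfrac{\alpha-\beta}{\alpha\gamma-\beta^2}}\,w,$$ $$U_{r_\lambda,\lambda}(r)=\sqrt{\lambda+P(r_\lambda)}\,U\big(\sqrt{\lambda+P(r_\lambda)}(r-r_\lambda)\big),\qquad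 V_{r_\lambda,\lambda}(r)=\sqrt{\lambda+Q(r_\lambda)}\,V\big(\sqrt{\lambda+Q(r_\lambda)}(r-r_\lambda)\big),$$ $$M_\lambda(r)=r\Big[1+\frac1\lambda\Big(\frac{\gamma-\beta}{\alpha+\gamma-2\beta}P(r)+\frac{\alpha-\beta}{\alpha+\gamma-2\beta}Q(r)\Big)\Big]^{3/2}.$$ Suppose that for every $n$ there is a radial classical solution $(u_\lambda,v_\lambda)\in H^1(\mathbb R^2)\times H^1(\mathbb R^2)$ of $$-\Delta u+(\lambda+P)u=\alpha u^3+\beta uv^2,\quad -\Delta v+(\lambda+Q)v=\gamma v^3+\beta u^2v\ \text{ in }\mathbb R^2,\qquad \int_{\mathbb R^2}(u^2+v^2)\,dx=1,$$ of the form $(u_\lambda,v_\lambda)=(U_{r_\lambda,\lambda},V_{r_\lambda,\lambda})+(\omega_{1,\lambda},\omega_{2,\lambda})$ with $$\|(\omega_{1,\lambda},\omega_{2,\lambda})\|_\lambda=o\big(\|(U_{r_\lambda,\lambda},V_{r_\lambda,\lambda})\|_\lambda\big).$$ Then $$\varepsilon=\frac{\alpha+\gamma-2\beta}{\alpha\gamma-\beta^2}\to0,\qquad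 r_\lambda\to+\infty .$$ If moreover the radial derivatives $P',Q'$ are uniformly continuous, then $M_\lambda'(r_\lambda)=o(1)$ or $(\gamma-\beta)P'(r_\lambda)+(\alpha-\beta)Q'(r_\lambda)=o(\alpha+\gamma-2\beta)$ (the latter is $o(1)$ as long as $\alpha+\gamma-2\beta$ stays bounded), in the following sense: $$\min\Big\{|M_\lambda'(r_\lambda)|,\ \Big|\frac{(\gamma-\beta)P'(r_\lambda)+(\alpha-\beta)Q'(r_\lambda)}{\alpha+\gamma-2\beta}\Big|\Big\}\to0 ,$$ the first alternative holds along the whole sequence if $r_\lambda/\lambda$ is bounded above, and the second one holds along the whole sequence if $r_\lambda/\lambda\to+\infty$. -/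

import Mathlib

open Filter Topology MeasureTheory

noncomputable section

namespace BEC

/-! ### The one-dimensional ground state -/

/-- `f` is a positive, radial (that is, even) `H¹(ℝ)` solution of `-f'' + f = f³` on `ℝ`. -/
structure IsGroundState (f : ℝ → ℝ) : Prop where
  contDiff : ContDiff ℝ 2 f
  pos : ∀ x, 0 < f x
  even : ∀ x, f (-x) = f x
  memLp : MemLp f 2 volume
  memLp_deriv : MemLp (deriv f) 2 volume
  ode : ∀ x, -(deriv (deriv f) x) + f x = f x ^ 3

/-- The function `w(x) = √2 / cosh x`; by `isGroundState_iff` it is the unique ground state. -/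
def w (x : ℝ) : ℝ := √2 / Real.cosh x

theorem hasDerivAt_w (x : ℝ) :
    HasDerivAt w (-(√2 * Real.sinh x) / Real.cosh x ^ 2) x := by
  have hc : Real.cosh x ≠ 0 := (Real.cosh_pos x).ne'
  have h := (hasDerivAt_const x (√2)).div (Real.hasDerivAt_cosh x) hc
  exact h.congr_deriv (by ring)

theorem deriv_w : deriv w = fun x => -(√2 * Real.sinh x) / Real.cosh x ^ 2 :=
  funext fun x => (hasDerivAt_w x).deriv

theorem w_pos (x : ℝ) : 0 < w x := div_pos (by positivity) (Real.cosh_pos x)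

theorem contDiff_w : ContDiff ℝ 2 w :=
  contDiff_const.div Real.contDiff_cosh fun x => (Real.cosh_pos x).ne'

theorem w_sq_le (x : ℝ) : w x ^ 2 ≤ 2 * (1 + x ^ 2)⁻¹ := by
  have h1 : 1 + x ^ 2 ≤ Real.cosh x ^ 2 := by
    have h2 := Real.cosh_sq x
    have h3 : x ^ 2 ≤ Real.sinh x ^ 2 := by
      rw [sq_le_sq, Real.abs_sinh]
      exact Real.self_le_sinh_iff.2 (abs_nonneg x)
    linarith
  have h2 : w x ^ 2 = 2 * (Real.cosh x ^ 2)⁻¹ := by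
    rw [w, div_pow, Real.sq_sqrt (by norm_num), div_eq_mul_inv]
  rw [h2]
  have : 0 < 1 + x ^ 2 := by positivity
  gcongr

theorem deriv_w_sq_le (x : ℝ) : deriv w x ^ 2 ≤ 2 * (1 + x ^ 2)⁻¹ := by
  refine le_trans ?_ (w_sq_le x)
  have hc := Real.cosh_pos x
  have h2 := Real.cosh_sq x
  have h3 : (√2 : ℝ) ^ 2 = 2 := Real.sq_sqrt (by norm_num)
  rw [deriv_w, w]
  simp only [div_pow, neg_sq, mul_pow, h3]
  rw [div_le_div_iff₀ (by positivity) (by positivity)]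
  nlinarith [pow_pos hc 2]

theorem isGroundState_w : IsGroundState w where
  contDiff := contDiff_w
  pos := w_pos
  even x := by simp [w]
  memLp := by
    rw [memLp_two_iff_integrable_sq contDiff_w.continuous.aestronglyMeasurable]
    refine (integrable_inv_one_add_sq.const_mul 2).mono'
      (contDiff_w.continuous.pow 2).aestronglyMeasurable (ae_of_all _ fun x => ?_)
    rw [Real.norm_eq_abs, abs_of_nonneg (sq_nonneg _)]
    exact w_sq_le x
  memLp_deriv := by
    have hc : Continuous (deriv w) := contDiff_w.continuous_deriv (by norm_num)
    rw [memLp_two_iff_integrable_sq hc.aestronglyMeasurable]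
    refine (integrable_inv_one_add_sq.const_mul 2).mono'
      (hc.pow 2).aestronglyMeasurable (ae_of_all _ fun x => ?_)
    rw [Real.norm_eq_abs, abs_of_nonneg (sq_nonneg _)]
    exact deriv_w_sq_le x
  ode x := by
    have hc : Real.cosh x ≠ 0 := (Real.cosh_pos x).ne'
    have h := (((Real.hasDerivAt_sinh x).const_mul (√2)).neg).div
      ((Real.hasDerivAt_cosh x).pow 2) (pow_ne_zero 2 hc)
    have h2 := Real.cosh_sq x
    have h3 : (√2 : ℝ) ^ 2 = 2 := Real.sq_sqrt (by norm_num)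
    have h4 := h.deriv
    rw [deriv_w]
    change -(deriv ((-fun y => √2 * Real.sinh y) / Real.cosh ^ 2) x) + w x = w x ^ 3
    rw [h4, w]
    simp only [Pi.pow_apply, Pi.neg_apply]
    have h5 : (√2 : ℝ) ^ 3 = 2 * √2 := by rw [pow_succ, h3]
    simp only [div_pow, h5]
    push_cast
    field_simp
    have h6 : Real.sinh x ^ 2 = Real.cosh x ^ 2 - 1 := by linarith
    ring_nf
    rw [h6]
    ring

theorem IsGroundState.eq_w {f : ℝ → ℝ} (hf : IsGroundState f) : f = w := by
  have hd : Differentiable ℝ f := hf.contDiff.differentiable (by norm_num)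
  have hd' : Differentiable ℝ (deriv f) :=
    (hf.contDiff.iterate_deriv' 1 1).differentiable (by norm_num)
  have h1 (x : ℝ) : HasDerivAt f (deriv f x) x := (hd x).hasDerivAt
  have h2 (x : ℝ) : HasDerivAt (deriv f) (f x - f x ^ 3) x := by
    have := (hd' x).hasDerivAt
    rwa [show deriv (deriv f) x = f x - f x ^ 3 by linarith [hf.ode x]] at this
  -- the energy is constant, and zero by integrability
  set E : ℝ → ℝ := fun x => deriv f x ^ 2 - f x ^ 2 + f x ^ 4 / 2 with hE
  have hEd (x : ℝ) : HasDerivAt E 0 x := by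
    have := (((h2 x).pow 2).sub ((h1 x).pow 2)).add (((h1 x).pow 4).div_const 2)
    refine this.congr_deriv ?_
    push_cast
    ring
  have hEc (x : ℝ) : E x = E 0 :=
    is_const_of_deriv_eq_zero (fun y => (hEd y).differentiableAt) (fun y => (hEd y).deriv) x 0
  have hsmall (δ : ℝ) (hδ : 0 < δ) : ∃ x, f x ^ 2 + deriv f x ^ 2 < δ := by
    by_contra! hcon
    have hi : Integrable (fun x => f x ^ 2 + deriv f x ^ 2) volume :=
      hf.memLp.integrable_sq.add hf.memLp_deriv.integrable_sq
    have hi2 : Integrable (fun _ : ℝ => δ) volume := by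
      refine hi.mono' aestronglyMeasurable_const (ae_of_all _ fun x => ?_)
      rw [Real.norm_eq_abs, abs_of_pos hδ]
      exact hcon x
    rw [integrable_const_iff] at hi2
    rcases hi2 with h | h
    · exact hδ.ne' h
    · have := h.measure_univ_lt_top
      simp at this
  have hE0 : E 0 = 0 := by
    by_contra hne
    obtain ⟨x, hx⟩ := hsmall (min 1 (|E 0| / 2)) (by positivity)
    have ha : f x ^ 2 + deriv f x ^ 2 < 1 := lt_of_lt_of_le hx (min_le_left _ _)
    have hb : f x ^ 2 + deriv f x ^ 2 < |E 0| / 2 := lt_of_lt_of_le hx (min_le_right _ _)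
    have hc : |E 0| ≤ 2 * (f x ^ 2 + deriv f x ^ 2) := by
      rw [← hEc x, abs_le]
      constructor <;> simp only [hE] <;>
        nlinarith [sq_nonneg (f x), sq_nonneg (deriv f x), sq_nonneg (f x ^ 2)]
    linarith
  have hfi (x : ℝ) : deriv f x ^ 2 = f x ^ 2 - f x ^ 4 / 2 := by
    have h : deriv f x ^ 2 - f x ^ 2 + f x ^ 4 / 2 = 0 := (hEc x).trans hE0
    linarith
  -- the reciprocal solves the linear equation `g'' = g`
  have hne (x : ℝ) : f x ≠ 0 := (hf.pos x).ne'
  have g1 (x : ℝ) : HasDerivAt (fun y => (f y)⁻¹) (-deriv f x / f x ^ 2) x := (h1 x).inv (hne x)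
  have g2 (x : ℝ) : HasDerivAt (fun y => -deriv f y / f y ^ 2) (f x)⁻¹ x := by
    have := ((h2 x).neg).div ((h1 x).pow 2) (pow_ne_zero 2 (hne x))
    refine this.congr_deriv ?_
    have h := hfi x
    have hx := hne x
    simp only [Pi.neg_apply, Pi.pow_apply]
    push_cast
    field_simp
    ring_nf
    rw [h]
    ring
  have hd0 : deriv f 0 = 0 := by
    have h := (h1 (-0)).comp (0 : ℝ) (hasDerivAt_neg (0 : ℝ))
    have h' : f ∘ Neg.neg = f := funext hf.even
    rw [h'] at h
    have := h.unique (h1 0)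
    simp at this
    linarith
  have hf0 : f 0 = √2 := by
    have h := hfi 0
    rw [hd0] at h
    have hp : 0 < f 0 ^ 2 := pow_pos (hf.pos 0) 2
    have : f 0 ^ 2 = 2 := by
      have h' : f 0 ^ 2 * (1 - f 0 ^ 2 / 2) = 0 := by linarith
      rcases mul_eq_zero.1 h' with h'' | h'' <;> linarith
    rw [← this, Real.sqrt_sq (hf.pos 0).le]
  have k1 (x : ℝ) : ((f x)⁻¹ + -deriv f x / f x ^ 2) * Real.exp (-x) = (√2)⁻¹ := by
    have hk (y : ℝ) : HasDerivAt
        (fun z => ((f z)⁻¹ + -deriv f z / f z ^ 2) * Real.exp (-z)) 0 y := by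
      have := ((g1 y).add (g2 y)).mul ((hasDerivAt_neg y).exp)
      refine this.congr_deriv ?_
      simp only [Pi.add_apply]
      ring
    have := is_const_of_deriv_eq_zero (fun y => (hk y).differentiableAt)
      (fun y => (hk y).deriv) x 0
    simpa [hd0, hf0] using this
  have k2 (x : ℝ) : ((f x)⁻¹ - -deriv f x / f x ^ 2) * Real.exp x = (√2)⁻¹ := by
    have hk (y : ℝ) : HasDerivAt
        (fun z => ((f z)⁻¹ - -deriv f z / f z ^ 2) * Real.exp z) 0 y := by
      have := ((g1 y).sub (g2 y)).mul (Real.hasDerivAt_exp y)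
      refine this.congr_deriv ?_
      simp only [Pi.sub_apply]
      ring
    have := is_const_of_deriv_eq_zero (fun y => (hk y).differentiableAt)
      (fun y => (hk y).deriv) x 0
    simpa [hd0, hf0] using this
  funext x
  have e1 : (f x)⁻¹ + -deriv f x / f x ^ 2 = (√2)⁻¹ * Real.exp x := by
    rw [← k1 x, mul_assoc, ← Real.exp_add]
    simp
  have e2 : (f x)⁻¹ - -deriv f x / f x ^ 2 = (√2)⁻¹ * Real.exp (-x) := by
    rw [← k2 x, mul_assoc, ← Real.exp_add]
    simp
  have e3 : (f x)⁻¹ = (√2)⁻¹ * Real.cosh x := by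
    rw [Real.cosh_eq]
    linarith
  rw [w, ← inv_inv (f x), e3, mul_inv, inv_inv, div_eq_mul_inv]

theorem isGroundState_iff (f : ℝ → ℝ) : IsGroundState f ↔ f = w :=
  ⟨IsGroundState.eq_w, fun h => h ▸ isGroundState_w⟩

/-! ### Radial functions on the plane and the system -/

/-- The Euclidean plane. -/
abbrev Plane : Type := EuclideanSpace ℝ (Fin 2)

/-- `f(x)` depends on `|x|` only. -/
def IsRadial (f : Plane → ℝ) : Prop := ∀ x y : Plane, ‖x‖ = ‖y‖ → f x = f y

/-- The radial profile `r ↦ f(r, 0)` of a radial function; for `r ≥ 0` this is `f` written as a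
function of `r = |x|`, and it is extended evenly to `r < 0`. -/
def profile (f : Plane → ℝ) (r : ℝ) : ℝ := f (EuclideanSpace.single 0 r)

/-- A radial `C¹` potential such that it and its radial derivative are bounded. -/
structure IsAdmissiblePotential (P : Plane → ℝ) : Prop where
  radial : IsRadial P
  contDiff : ContDiff ℝ 1 P
  bounded : ∃ C : ℝ, ∀ x, |P x| ≤ C
  deriv_bounded : ∃ C : ℝ, ∀ r, |deriv (profile P) r| ≤ C

/-- `u` is in `H¹(ℝ²)`, for differentiable `u`. -/
def InH1 (u : Plane → ℝ) : Prop := MemLp u 2 volume ∧ MemLp (fderiv ℝ u) 2 volume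

/-- `(u, v)` is a radial (classical, finite energy) solution of the two-component system
`-Δu + (lam + P) u = α u³ + β u v²`, `-Δv + (lam + Q) v = γ v³ + β u² v` in `ℝ²`
with the constraint `∫ (u² + v²) = 1`. -/
structure IsRadialSolution (P Q : Plane → ℝ) (α β γ lam : ℝ) (u v : Plane → ℝ) : Prop where
  contDiff_u : ContDiff ℝ 2 u
  contDiff_v : ContDiff ℝ 2 v
  radial_u : IsRadial u
  radial_v : IsRadial v
  inH1_u : InH1 u
  inH1_v : InH1 v
  eq_u : ∀ x, -(Laplacian.laplacian u x) + (lam + P x) * u x = α * u x ^ 3 + β * u x * v x ^ 2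
  eq_v : ∀ x, -(Laplacian.laplacian v x) + (lam + Q x) * v x = γ * v x ^ 3 + β * u x ^ 2 * v x
  mass : ∫ x, (u x ^ 2 + v x ^ 2) = 1

/-! ### The approximate solution, the norm, and the auxiliary function -/

/-- `ε = (α + γ - 2β) / (αγ - β²)`. -/
def eps (α β γ : ℝ) : ℝ := (α + γ - 2 * β) / (α * γ - β ^ 2)

/-- First component `U` of the synchronized solution of the limit system. -/
def limU (α β γ : ℝ) (x : ℝ) : ℝ := √((γ - β) / (α * γ - β ^ 2)) * w x

/-- Second component `V` of the synchronized solution of the limit system. -/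
def limV (α β γ : ℝ) (x : ℝ) : ℝ := √((α - β) / (α * γ - β ^ 2)) * w x

/-- `U_{t,lam}(r) = √(lam + P(t)) U(√(lam + P(t)) (r - t))`. -/
def peakU (P : Plane → ℝ) (α β γ lam t r : ℝ) : ℝ :=
  √(lam + profile P t) * limU α β γ (√(lam + profile P t) * (r - t))

/-- `V_{t,lam}(r) = √(lam + Q(t)) V(√(lam + Q(t)) (r - t))`. -/
def peakV (Q : Plane → ℝ) (α β γ lam t r : ℝ) : ℝ :=
  √(lam + profile Q t) * limV α β γ (√(lam + profile Q t) * (r - t))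

/-- The square of the weighted norm of one component:
`∫₀^∞ r (|f'|² + (lam + P(r)) f²) dr`. -/
def normSq (P : Plane → ℝ) (lam : ℝ) (f : ℝ → ℝ) : ℝ :=
  ∫ r in Set.Ioi (0 : ℝ), r * (deriv f r ^ 2 + (lam + profile P r) * f r ^ 2)

/-- The norm `‖(f, g)‖_lam`. -/
def pairNorm (P Q : Plane → ℝ) (lam : ℝ) (f g : ℝ → ℝ) : ℝ :=
  √(normSq P lam f + normSq Q lam g)

/-- `M_lam(r) = r (1 + ((γ-β)/(α+γ-2β) P(r) + (α-β)/(α+γ-2β) Q(r)) / lam)^{3/2}`. -/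
def M (P Q : Plane → ℝ) (α β γ lam r : ℝ) : ℝ :=
  r * (1 + 1 / lam * ((γ - β) / (α + γ - 2 * β) * profile P r
    + (α - β) / (α + γ - 2 * β) * profile Q r)) ^ (3 / 2 : ℝ)

/-- `(γ - β) P'(r) + (α - β) Q'(r)`. -/
def weightedDeriv (P Q : Plane → ℝ) (α β γ r : ℝ) : ℝ :=
  (γ - β) * deriv (profile P) r + (α - β) * deriv (profile Q) r

end BEC

end

/-!
The theorem is a localized Pohozaev identity, evaluated on the peaks.

In the radial variable the system has a Hamiltonian `E`, and for a multiplier `ψ` the derivative of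
`ψ E + ψ' (u u' + v v') / 4` contains no quartic term (`pohozaev_identity`). This matters because
`α`, `β`, `γ` are not assumed bounded: what is left is a quadratic form in `(u, v)`, which is
controlled by the weighted norm alone. With `ψ = r² χ(r / R)` for a cutoff `χ` and
`R = max 1 r_lam` it reads (`energyForm_eq_virialForm`)

`∫ r² χ (P' u² + Q' v²) = ∫ r (u'² + v'² - (lam + P) u² - (lam + Q) v²) + terms living on r ≥ 2 R`.

Since both sides are quadratic, `(u, v)` may be replaced by the pair of peaks at the cost of a small
multiple of `(lam + R) μ`, where `μ` is the total mass of the peaks (`energyForm_stability`,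
`virialForm_stability`, `pohozaev_peaks`).

For a peak, `∫ r U'²` and `∫ r U²` are first moments of `w'²` and `w²`, and
`3 ∫ (A + y)₊ w'² = ∫ (A + y)₊ w² + w(A)² / 2` (`three_mul_moment_deriv_w`). Hence the right side
is at most `-(lam / 4) μ` wherever the peaks are, while the left side is at most `C R μ`: so
`R ≥ c lam`, which means `R = r_lam → ∞` (`lam_le_of_pohozaev`), and the normalization of the mass
then gives `ε → 0`. Once the peaks are far away, the right side is `-(2/3) lam μ + o(lam μ)` by the
same formula, and the left side is `r_lam μ` times the average of `P'(r_lam)` and `Q'(r_lam)` with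
the masses of the peaks as weights, by uniform continuity of the derivatives. These masses have the
ratio `γ - β : α - β` in the limit. So

`((γ - β) P'(r_lam) + (α - β) Q'(r_lam)) / (α + γ - 2β) + (2/3) lam / r_lam → 0`

(`balance_of_pohozaev`), and this single limit contains the whole alternative: `M'(r_lam)` is
`(3/2) (r_lam / lam)` times this quantity up to a bounded factor and a term `O(1 / lam)`
(`abs_deriv_M_le`), while the curvature term `lam / r_lam` is negligible if `r_lam / lam → ∞`.
-/

open Set

noncomputable section

namespace BEC

/-! ### The ground state and its moments -/

theorem continuous_w : Continuous w := contDiff_w.continuous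

theorem continuous_deriv_w : Continuous (deriv w) := contDiff_w.continuous_deriv (by norm_num)

theorem hasDerivAt_w' (x : ℝ) : HasDerivAt w (deriv w x) x :=
  (contDiff_w.differentiable (by norm_num) x).hasDerivAt

theorem hasDerivAt_deriv_w (x : ℝ) : HasDerivAt (deriv w) (w x - w x ^ 3) x := by
  have hd : Differentiable ℝ (deriv w) :=
    (contDiff_w.iterate_deriv' 1 1).differentiable (by norm_num)
  have h := (hd x).hasDerivAt
  rwa [show deriv (deriv w) x = w x - w x ^ 3 by linarith [isGroundState_w.ode x]] at h

/-- The first integral of `-w'' + w = w³`. -/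
theorem deriv_w_sq (x : ℝ) : deriv w x ^ 2 = w x ^ 2 - w x ^ 4 / 2 := by
  have hc : Real.cosh x ≠ 0 := (Real.cosh_pos x).ne'
  have h3 : (√2 : ℝ) ^ 2 = 2 := Real.sq_sqrt (by norm_num)
  have h4 : (√2 : ℝ) ^ 4 = 4 := by rw [show (4 : ℕ) = 2 * 2 by norm_num, pow_mul, h3]; norm_num
  simp only [deriv_w, w, div_pow, neg_sq, mul_pow, h3, h4, Real.sinh_sq]
  field_simp
  ring

theorem deriv_w_sq_le_w_sq (x : ℝ) : deriv w x ^ 2 ≤ w x ^ 2 := by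
  rw [deriv_w_sq]
  have : 0 ≤ w x ^ 4 := pow_nonneg (w_pos x).le 4
  linarith

theorem w_sq_le_two (x : ℝ) : w x ^ 2 ≤ 2 := by
  refine (w_sq_le x).trans ?_
  have : (1 + x ^ 2)⁻¹ ≤ 1 := inv_le_one_of_one_le₀ (by nlinarith [sq_nonneg x])
  linarith

theorem one_add_abs_sq_mul_w_sq_le (x : ℝ) : (1 + |x|) ^ 2 * w x ^ 2 ≤ 16 * (1 + x ^ 2)⁻¹ := by
  have h0 : 1 + x ^ 2 / 2 ≤ Real.cosh x := by
    have h1 : Real.cosh x = 1 + 2 * Real.sinh (x / 2) ^ 2 := by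
      have h2 := Real.cosh_two_mul (x / 2)
      rw [mul_div_cancel₀ x (two_ne_zero), Real.cosh_sq] at h2
      linarith
    have h3 : (x / 2) ^ 2 ≤ Real.sinh (x / 2) ^ 2 := by
      rw [sq_le_sq, Real.abs_sinh]
      exact Real.self_le_sinh_iff.2 (abs_nonneg _)
    nlinarith
  have h2 : w x ^ 2 = 2 * (Real.cosh x ^ 2)⁻¹ := by
    rw [w, div_pow, Real.sq_sqrt (by norm_num), div_eq_mul_inv]
  have h4 : (1 + |x|) ^ 2 ≤ 2 * (1 + x ^ 2) := by
    nlinarith [sq_nonneg (1 - |x|), sq_abs x]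
  have h5 : (1 + x ^ 2) ^ 2 ≤ 4 * Real.cosh x ^ 2 := by
    nlinarith [sq_nonneg x]
  have hc : 0 < Real.cosh x ^ 2 := pow_pos (Real.cosh_pos x) 2
  have hx : 0 < 1 + x ^ 2 := by positivity
  rw [h2, ← div_eq_mul_inv, ← div_eq_mul_inv, mul_div_assoc', div_le_div_iff₀ hc hx]
  nlinarith [mul_le_mul_of_nonneg_right h4 hx.le]

theorem integrable_one_add_abs_mul_w_sq : Integrable (fun x => (1 + |x|) * w x ^ 2) := by
  refine (integrable_inv_one_add_sq.const_mul 16).mono'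
    (by have := continuous_w; fun_prop) (ae_of_all _ fun x => ?_)
  rw [Real.norm_eq_abs, abs_of_nonneg (by positivity)]
  refine le_trans ?_ (one_add_abs_sq_mul_w_sq_le x)
  have : 0 ≤ |x| := abs_nonneg x
  gcongr
  nlinarith

theorem tendsto_one_add_abs_mul_w : Tendsto (fun x => (1 + |x|) * w x) atTop (𝓝 0) := by
  have h1 : Tendsto (fun x : ℝ => √(16 * (1 + x ^ 2)⁻¹)) atTop (𝓝 0) := by
    have : Tendsto (fun x : ℝ => 16 * (1 + x ^ 2)⁻¹) atTop (𝓝 (16 * 0)) := by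
      refine Tendsto.const_mul _ (tendsto_inv_atTop_zero.comp ?_)
      exact tendsto_atTop_add_const_left _ _ (tendsto_pow_atTop two_ne_zero)
    simpa using this.sqrt
  refine squeeze_zero (fun x => by have := w_pos x; positivity) (fun x => ?_) h1
  refine Real.le_sqrt_of_sq_le ?_
  rw [mul_pow]
  exact one_add_abs_sq_mul_w_sq_le x

/-- The first moment `∫ (A + y)₊ f(y) dy`, to which radial integrals of a profile centred at
distance `A` from the origin reduce. -/
def moment (A : ℝ) (f : ℝ → ℝ) : ℝ := ∫ y, max (A + y) 0 * f y

theorem max_add_le {A : ℝ} (hA : 0 ≤ A) (y : ℝ) : max (A + y) 0 ≤ (1 + A) * (1 + |y|) := by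
  have := abs_nonneg y
  have := le_abs_self y
  refine max_le ?_ (by positivity)
  nlinarith

/-- Measurable `f` bounded by `w²` has finite first moment. -/
theorem integrable_moment {A : ℝ} (hA : 0 ≤ A) {f : ℝ → ℝ} (hf : AEStronglyMeasurable f)
    (hb : ∀ y, |f y| ≤ w y ^ 2) : Integrable (fun y => max (A + y) 0 * f y) := by
  refine (integrable_one_add_abs_mul_w_sq.const_mul (1 + A)).mono'
    (AEStronglyMeasurable.mul (by fun_prop) hf) (ae_of_all _ fun x => ?_)
  rw [Real.norm_eq_abs, abs_mul, abs_of_nonneg (le_max_right _ _)]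
  rw [← mul_assoc]
  exact mul_le_mul (max_add_le hA x) (hb x) (abs_nonneg _) (by positivity)

theorem integrable_moment_w {A : ℝ} (hA : 0 ≤ A) :
    Integrable (fun y => max (A + y) 0 * w y ^ 2) :=
  integrable_moment hA (by have := continuous_w; fun_prop) fun y => by
    rw [abs_of_nonneg (sq_nonneg _)]

theorem integrable_moment_deriv_w {A : ℝ} (hA : 0 ≤ A) :
    Integrable (fun y => max (A + y) 0 * deriv w y ^ 2) :=
  integrable_moment hA (by have := continuous_deriv_w; fun_prop) fun y => by
    rw [abs_of_nonneg (sq_nonneg _)]; exact deriv_w_sq_le_w_sq y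

theorem max_mul_eq_indicator (A : ℝ) (f : ℝ → ℝ) :
    (fun y => max (A + y) 0 * f y) = (Ioi (-A)).indicator fun y => (A + y) * f y := by
  funext y
  by_cases hy : y ∈ Ioi (-A)
  · rw [indicator_of_mem hy, max_eq_left]
    linarith [mem_Ioi.1 hy]
  · rw [indicator_of_notMem hy, max_eq_right, zero_mul]
    linarith [notMem_Ioi.1 hy]

theorem moment_eq_setIntegral (A : ℝ) (f : ℝ → ℝ) :
    moment A f = ∫ y in Ioi (-A), (A + y) * f y := by
  rw [moment, max_mul_eq_indicator, integral_indicator measurableSet_Ioi]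

theorem integrableOn_moment_iff (A : ℝ) (f : ℝ → ℝ) :
    Integrable (fun y => max (A + y) 0 * f y) ↔
      IntegrableOn (fun y => (A + y) * f y) (Ioi (-A)) := by
  rw [max_mul_eq_indicator, integrable_indicator_iff measurableSet_Ioi]

/-- A weighted Pohozaev identity for `w`: `(A + y)(3 w'² - w²)` is the derivative of
`(A + y) w w' - w² / 2`. -/
theorem three_mul_moment_deriv_w {A : ℝ} (hA : 0 ≤ A) :
    3 * moment A (fun y => deriv w y ^ 2) = moment A (fun y => w y ^ 2) + w A ^ 2 / 2 := by
  have hi1 := (integrableOn_moment_iff A _).1 (integrable_moment_w hA)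
  have hi2 := (integrableOn_moment_iff A _).1 (integrable_moment_deriv_w hA)
  have hlim : Tendsto (fun y => (A + y) * (w y * deriv w y) - w y ^ 2 / 2) atTop (𝓝 0) := by
    have h1 : Tendsto (fun y => (1 + A) * ((1 + |y|) * w y) ^ 2 + ((1 + |y|) * w y) ^ 2)
        atTop (𝓝 0) := by
      have := ((tendsto_one_add_abs_mul_w.pow 2).const_mul (1 + A)).add
        (tendsto_one_add_abs_mul_w.pow 2)
      simpa using this
    refine squeeze_zero_norm (fun y => ?_) h1
    have hy := abs_nonneg y
    have hy' := abs_le.1 (le_refl |y|)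
    have h2 : |deriv w y| ≤ w y := abs_le_of_sq_le_sq (deriv_w_sq_le_w_sq y) (w_pos y).le
    have h3 := w_pos y
    rw [Real.norm_eq_abs]
    refine (abs_sub _ _).trans (add_le_add ?_ ?_)
    · rw [abs_mul, abs_mul, abs_of_pos h3, mul_pow, ← mul_assoc]
      have h4 : |A + y| ≤ (1 + A) * (1 + |y|) ^ 2 := by
        refine (abs_add_le _ _).trans ?_
        rw [abs_of_nonneg hA]
        nlinarith [mul_nonneg hA hy, mul_nonneg hA (sq_nonneg |y|)]
      calc |A + y| * w y * |deriv w y| ≤ ((1 + A) * (1 + |y|) ^ 2) * w y * w y := by gcongr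
        _ = _ := by ring
    · rw [abs_of_nonneg (by positivity), mul_pow]
      have h5 : 1 ≤ (1 + |y|) ^ 2 := by nlinarith
      nlinarith [sq_nonneg (w y)]
  have hd (y : ℝ) : HasDerivAt (fun y => (A + y) * (w y * deriv w y) - w y ^ 2 / 2)
      (3 * ((A + y) * deriv w y ^ 2) - (A + y) * w y ^ 2) y := by
    have h := (((hasDerivAt_id y).const_add A).mul
      ((hasDerivAt_w' y).mul (hasDerivAt_deriv_w y))).sub (((hasDerivAt_w' y).pow 2).div_const 2)
    refine h.congr_deriv ?_
    have h4 : w y * w y ^ 3 = 2 * w y ^ 2 - 2 * deriv w y ^ 2 := by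
      rw [deriv_w_sq]; ring
    simp only [id, Pi.mul_apply]
    push_cast
    linear_combination (-(A + y)) * h4
  have key := integral_Ioi_of_hasDerivAt_of_tendsto (a := -A)
    (hd (-A)).continuousAt.continuousWithinAt (fun y _ => hd y) ((hi2.const_mul 3).sub hi1) hlim
  have hev : w (-A) = w A := isGroundState_w.even A
  rw [integral_sub (hi2.const_mul 3) hi1, integral_const_mul, ← moment_eq_setIntegral,
    ← moment_eq_setIntegral, hev] at key
  simp only [add_neg_cancel, zero_mul, zero_sub, sub_neg_eq_add] at key
  linarith

/-- Note that `1 - w² / 2 = tanh²`. -/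
theorem tendsto_tanh_sq : Tendsto (fun x => 1 - w x ^ 2 / 2) atTop (𝓝 1) := by
  have h1 : Tendsto (fun x => w x ^ 2) atTop (𝓝 0) := by
    have h2 : Tendsto (fun x => ((1 + |x|) * w x) ^ 2) atTop (𝓝 0) := by
      simpa using tendsto_one_add_abs_mul_w.pow 2
    refine squeeze_zero (fun x => sq_nonneg _) (fun x => ?_) h2
    rw [mul_pow]
    have h5 : 1 ≤ (1 + |x|) ^ 2 := by nlinarith [abs_nonneg x]
    nlinarith [sq_nonneg (w x)]
  simpa using (h1.div_const 2).const_sub 1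

/-- On the half-line `y ≥ 0` one has `(A + y) w² ≥ (2 A tanh + tanh²)'`. -/
theorem two_mul_add_one_le_moment_w {A : ℝ} (hA : 0 ≤ A) :
    2 * A + 1 ≤ moment A (fun y => w y ^ 2) := by
  -- the bound on `[0, L]`, before passing to the limit `L → ∞`
  have hL (L : ℝ) (hL : 0 ≤ L) : (2 * A + 1) * (1 - w L ^ 2 / 2) ≤ moment A (fun y => w y ^ 2) := by
    set τ : ℝ → ℝ := fun y => Real.sinh y / Real.cosh y
    have hsq (y : ℝ) : w y ^ 2 = 2 * (1 - τ y ^ 2) := by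
      have hc : Real.cosh y ≠ 0 := (Real.cosh_pos y).ne'
      simp only [w, τ, div_pow, Real.sq_sqrt (show (0 : ℝ) ≤ 2 by norm_num), Real.sinh_sq]
      field_simp
      ring
    have hτ (y : ℝ) : HasDerivAt τ (w y ^ 2 / 2) y := by
      have hc : Real.cosh y ≠ 0 := (Real.cosh_pos y).ne'
      refine ((Real.hasDerivAt_sinh y).div (Real.hasDerivAt_cosh y) hc).congr_deriv ?_
      rw [hsq]
      simp only [τ]
      field_simp
    have hτ0 {y : ℝ} (hy : 0 ≤ y) : 0 ≤ τ y :=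
      div_nonneg (Real.sinh_nonneg_iff.2 hy) (Real.cosh_pos y).le
    have hτ1 (y : ℝ) : τ y ≤ 1 := (div_le_one (Real.cosh_pos y)).2 (Real.sinh_lt_cosh y).le
    have hτy {y : ℝ} (hy : 0 ≤ y) : τ y ≤ y := by
      have hd : Differentiable ℝ τ := fun z => (hτ z).differentiableAt
      have h := (convex_univ : Convex ℝ (univ : Set ℝ)).image_sub_le_mul_sub_of_deriv_le
        hd.continuous.continuousOn hd.differentiableOn (C := 1)
        (fun z _ => by rw [(hτ z).deriv]; linarith [w_sq_le_two z]) 0 (mem_univ _) y (mem_univ _) hy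
      simpa [τ] using h
    have hcw := continuous_w
    have hF (y : ℝ) : HasDerivAt (fun y => 2 * A * τ y + τ y ^ 2) ((A + τ y) * w y ^ 2) y := by
      refine (((hτ y).const_mul (2 * A)).add ((hτ y).pow 2)).congr_deriv ?_
      push_cast
      ring
    have hcτ : Continuous τ := continuous_iff_continuousAt.2 fun y => (hτ y).continuousAt
    have hFTC := intervalIntegral.integral_eq_sub_of_hasDerivAt (a := 0) (b := L)
      (fun y _ => hF y) (by apply Continuous.intervalIntegrable; fun_prop)
    have hτ00 : τ 0 = 0 := by simp [τ]
    rw [hτ00, intervalIntegral.integral_of_le hL] at hFTC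
    have h1 : ∫ y in Ioc 0 L, (A + τ y) * w y ^ 2 ≤ moment A (fun y => w y ^ 2) := by
      have hint := integrable_moment_w hA
      refine le_trans (setIntegral_mono_on ?_ hint.integrableOn measurableSet_Ioc fun y hy => ?_)
        (setIntegral_le_integral hint (ae_of_all _ fun y => by positivity))
      · exact (Continuous.integrableOn_Icc (by fun_prop)).mono_set Ioc_subset_Icc_self
      · gcongr
        exact (add_le_add_right (hτy hy.1.le) A).trans (le_max_left _ _)
    refine le_trans ?_ h1
    rw [hFTC, show 1 - w L ^ 2 / 2 = τ L ^ 2 by rw [hsq]; ring]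
    have h0 := hτ0 hL
    have h1 := hτ1 L
    nlinarith [mul_nonneg hA h0, mul_le_mul_of_nonneg_left h1 h0,
      mul_nonneg (mul_nonneg hA h0) (sub_nonneg.2 h1)]
  refine le_of_tendsto' (f := fun n : ℕ => (2 * A + 1) * (1 - w (n : ℝ) ^ 2 / 2)) (x := atTop) ?_
    fun n => hL n (Nat.cast_nonneg n)
  have := (tendsto_tanh_sq.comp (tendsto_natCast_atTop_atTop (R := ℝ))).const_mul (2 * A + 1)
  simpa using this

theorem moment_deriv_w_le {A : ℝ} (hA : 0 ≤ A) :
    moment A (fun y => deriv w y ^ 2) ≤ 2 / 3 * moment A (fun y => w y ^ 2) := by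
  have h1 := three_mul_moment_deriv_w hA
  have h2 := two_mul_add_one_le_moment_w hA
  have h3 := w_sq_le_two A
  linarith

theorem moment_w_lipschitz : ∃ C : ℝ, 0 ≤ C ∧ ∀ A B : ℝ, 0 ≤ A → 0 ≤ B →
    |moment A (fun y => w y ^ 2) - moment B (fun y => w y ^ 2)| ≤ C * |A - B| := by
  have hi : Integrable (fun y => w y ^ 2) := isGroundState_w.memLp.integrable_sq
  refine ⟨∫ y, w y ^ 2, integral_nonneg fun y => sq_nonneg _, fun A B hA hB => ?_⟩
  rw [moment, moment, ← integral_sub (integrable_moment_w hA) (integrable_moment_w hB),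
    mul_comm, ← integral_const_mul]
  refine le_of_eq_of_le (Real.norm_eq_abs _).symm
    (norm_integral_le_of_norm_le (hi.const_mul _) (ae_of_all _ fun y => ?_))
  rw [← sub_mul, norm_mul, Real.norm_eq_abs, Real.norm_eq_abs, abs_of_nonneg (sq_nonneg (w y))]
  refine mul_le_mul_of_nonneg_right ?_ (sq_nonneg _)
  have := abs_max_sub_max_le_abs (A + y) (B + y) 0
  rwa [add_sub_add_right_eq_sub] at this

/-- The part of the first moment at distance at least `L` from the centre of `w`; the gain `1 / L`
comes from the decay of `w`. -/
theorem moment_indicator_le {A L : ℝ} (hA : 0 ≤ A) (hL : 0 ≤ L) :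
    moment A ({y | L ≤ |y|}.indicator fun y => w y ^ 2) ≤
      16 * Real.pi * (1 + A) / (1 + L) := by
  have h1 : 16 * Real.pi * (1 + A) / (1 + L)
      = ∫ y : ℝ, (16 * (1 + A) / (1 + L)) * (1 + y ^ 2)⁻¹ := by
    rw [integral_const_mul, integral_univ_inv_one_add_sq]
    ring
  rw [h1, moment]
  refine integral_mono_of_nonneg (ae_of_all _ fun y => ?_)
    (integrable_inv_one_add_sq.const_mul _) (ae_of_all _ fun y => ?_)
  · exact mul_nonneg (le_max_right _ _) (indicator_nonneg (fun _ _ => sq_nonneg _) _)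
  · have hy := abs_nonneg y
    by_cases h : L ≤ |y|
    · simp only
      rw [indicator_of_mem (show y ∈ {y : ℝ | L ≤ |y|} from h)]
      have h2 := one_add_abs_sq_mul_w_sq_le y
      have h3 := max_add_le hA y
      calc max (A + y) 0 * w y ^ 2 ≤ (1 + A) * (1 + |y|) * w y ^ 2 := by gcongr
        _ = (1 + A) / (1 + L) * ((1 + L) * (1 + |y|) * w y ^ 2) := by field_simp
        _ ≤ (1 + A) / (1 + L) * ((1 + |y|) ^ 2 * w y ^ 2) := by
            rw [sq (1 + |y|)]; gcongr
        _ ≤ (1 + A) / (1 + L) * (16 * (1 + y ^ 2)⁻¹) := by gcongr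
        _ = _ := by ring
    · simp only
      rw [indicator_of_notMem (show y ∉ {y : ℝ | L ≤ |y|} from h), mul_zero]
      positivity

/-! ### Peaks and their masses -/

/-- The mass `∫₀^∞ r f(r)² dr` of a radial profile, up to the factor `2π` of the plane. -/
def mass (f : ℝ → ℝ) : ℝ := ∫ r in Ioi (0 : ℝ), r * f r ^ 2

/-- A `C¹` radial profile on the half-line that belongs to the weighted `H¹` space. -/
structure FiniteEnergy (f : ℝ → ℝ) : Prop where
  contDiff : ContDiff ℝ 1 f
  integrableOn : IntegrableOn (fun r => r * f r ^ 2) (Ioi 0)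
  integrableOn_deriv : IntegrableOn (fun r => r * deriv f r ^ 2) (Ioi 0)

theorem mass_nonneg (f : ℝ → ℝ) : 0 ≤ mass f :=
  setIntegral_nonneg measurableSet_Ioi fun r hr => by
    have : (0 : ℝ) < r := hr
    positivity

/-- The profile of height `k a` and width `1 / k` centred at `ρ`. -/
def peak (a k ρ s : ℝ) : ℝ := k * (a * w (k * (s - ρ)))

theorem contDiff_peak (a k ρ : ℝ) : ContDiff ℝ 1 (peak a k ρ) := by
  have h : ContDiff ℝ 1 w := contDiff_w.of_le (by norm_num)
  exact contDiff_const.mul (contDiff_const.mul (h.comp (by fun_prop)))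

theorem hasDerivAt_peak (a k ρ s : ℝ) :
    HasDerivAt (peak a k ρ) (k * (k * (a * deriv w (k * (s - ρ))))) s := by
  have h1 : HasDerivAt (fun s => k * (s - ρ)) k s := by
    simpa using ((hasDerivAt_id s).sub_const ρ).const_mul k
  have h := (((hasDerivAt_w' (k * (s - ρ))).comp s h1).const_mul a).const_mul k
  refine h.congr_deriv ?_
  ring

theorem deriv_peak_sq_le (a k ρ s : ℝ) : deriv (peak a k ρ) s ^ 2 ≤ k ^ 2 * peak a k ρ s ^ 2 := by
  rw [(hasDerivAt_peak a k ρ s).deriv, peak, mul_pow k]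
  gcongr k ^ 2 * ?_
  have h := deriv_w_sq_le_w_sq (k * (s - ρ))
  rw [mul_pow, mul_pow a, mul_pow, mul_pow a]
  gcongr

/-- The change of variables `y = k (r - ρ)` turns the weight `r` on the half-line into the weight
`(k ρ + y)₊ / k` on the line. -/
theorem indicator_comp_eq {k ρ : ℝ} (hk : 0 < k) (f : ℝ → ℝ) :
    (Ioi (0 : ℝ)).indicator (fun r => r * f (k * (r - ρ)))
      = fun r => (fun y => k⁻¹ * (max (k * ρ + y) 0 * f y)) (k * (r - ρ)) := by
  funext r
  have h : k * ρ + k * (r - ρ) = k * r := by ring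
  simp only [h]
  by_cases hr : r ∈ Ioi (0 : ℝ)
  · rw [indicator_of_mem hr, max_eq_left (mul_nonneg hk.le (le_of_lt hr))]
    field_simp
  · rw [indicator_of_notMem hr]
    simp only [mem_Ioi, not_lt] at hr
    rw [max_eq_right (by nlinarith), zero_mul, mul_zero]

theorem setIntegral_comp_eq_moment {k : ℝ} (hk : 0 < k) (ρ : ℝ) (f : ℝ → ℝ) :
    ∫ r in Ioi (0 : ℝ), r * f (k * (r - ρ)) = (k ^ 2)⁻¹ * moment (k * ρ) f := by
  rw [← integral_indicator measurableSet_Ioi, indicator_comp_eq hk,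
    integral_sub_right_eq_self (fun r => (fun y => k⁻¹ * (max (k * ρ + y) 0 * f y)) (k * r)) ρ,
    Measure.integral_comp_mul_left (fun y => k⁻¹ * (max (k * ρ + y) 0 * f y)) k,
    integral_const_mul, ← moment, abs_of_pos (inv_pos.2 hk),
    smul_eq_mul, sq, mul_inv, mul_assoc]

theorem integrableOn_comp {k : ℝ} (hk : 0 < k) (ρ : ℝ) {f : ℝ → ℝ}
    (hf : Integrable (fun y => max (k * ρ + y) 0 * f y)) :
    IntegrableOn (fun r => r * f (k * (r - ρ))) (Ioi 0) := by
  rw [← integrable_indicator_iff measurableSet_Ioi, indicator_comp_eq hk]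
  exact ((hf.const_mul k⁻¹).comp_mul_left' hk.ne').comp_sub_right ρ

theorem mass_peak (a : ℝ) {k : ℝ} (hk : 0 < k) (ρ : ℝ) :
    mass (peak a k ρ) = a ^ 2 * moment (k * ρ) (fun y => w y ^ 2) := by
  have h := setIntegral_comp_eq_moment hk ρ (fun y => w y ^ 2)
  have h2 (r : ℝ) : r * peak a k ρ r ^ 2 = k ^ 2 * a ^ 2 * (r * w (k * (r - ρ)) ^ 2) := by
    rw [peak]; ring
  simp only [mass, h2]
  rw [integral_const_mul, h]
  field_simp

theorem mass_deriv_peak (a : ℝ) {k : ℝ} (hk : 0 < k) (ρ : ℝ) :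
    mass (deriv (peak a k ρ)) = k ^ 2 * a ^ 2 * moment (k * ρ) (fun y => deriv w y ^ 2) := by
  have h := setIntegral_comp_eq_moment hk ρ (fun y => deriv w y ^ 2)
  have h2 (r : ℝ) : r * deriv (peak a k ρ) r ^ 2
      = k ^ 4 * a ^ 2 * (r * deriv w (k * (r - ρ)) ^ 2) := by
    rw [(hasDerivAt_peak a k ρ r).deriv]; ring
  simp only [mass, h2]
  rw [integral_const_mul, h]
  field_simp

theorem finiteEnergy_peak (a : ℝ) {k ρ : ℝ} (hk : 0 < k) (hρ : 0 ≤ ρ) :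
    FiniteEnergy (peak a k ρ) where
  contDiff := contDiff_peak a k ρ
  integrableOn := by
    have h2 (r : ℝ) : r * peak a k ρ r ^ 2 = k ^ 2 * a ^ 2 * (r * w (k * (r - ρ)) ^ 2) := by
      rw [peak]; ring
    simp only [h2]
    exact (integrableOn_comp hk ρ (f := fun y => w y ^ 2)
      (integrable_moment_w (by positivity))).const_mul _
  integrableOn_deriv := by
    have h2 (r : ℝ) : r * deriv (peak a k ρ) r ^ 2
        = k ^ 4 * a ^ 2 * (r * deriv w (k * (r - ρ)) ^ 2) := by
      rw [(hasDerivAt_peak a k ρ r).deriv]; ring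
    simp only [h2]
    exact (integrableOn_comp hk ρ (f := fun y => deriv w y ^ 2)
      (integrable_moment_deriv_w (by positivity))).const_mul _

theorem le_mass_peak (a : ℝ) {k ρ : ℝ} (hk : 0 < k) (hρ : 0 ≤ ρ) :
    a ^ 2 * (1 + 2 * (k * ρ)) ≤ mass (peak a k ρ) := by
  rw [mass_peak a hk]
  have := two_mul_add_one_le_moment_w (mul_nonneg hk.le hρ)
  gcongr
  linarith

theorem mass_peak_pos {a k ρ : ℝ} (ha : 0 < a) (hk : 0 < k) (hρ : 0 ≤ ρ) :
    0 < mass (peak a k ρ) := lt_of_lt_of_le (by positivity) (le_mass_peak a hk hρ)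

theorem mass_deriv_peak_le (a : ℝ) {k ρ : ℝ} (hk : 0 < k) (hρ : 0 ≤ ρ) :
    mass (deriv (peak a k ρ)) ≤ 2 / 3 * k ^ 2 * mass (peak a k ρ) := by
  rw [mass_peak a hk, mass_deriv_peak a hk]
  have := moment_deriv_w_le (mul_nonneg hk.le hρ)
  calc _ ≤ k ^ 2 * a ^ 2 * (2 / 3 * moment (k * ρ) fun y => w y ^ 2) := by gcongr
    _ = _ := by ring

/-- Equipartition: a peak far from the origin carries one third of `k²` times its mass as
gradient energy. -/
theorem abs_mass_deriv_peak_sub_le (a : ℝ) {k ρ : ℝ} (hk : 0 < k) (hρ : 0 ≤ ρ) :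
    |mass (deriv (peak a k ρ)) - k ^ 2 / 3 * mass (peak a k ρ)| * (1 + 2 * (k * ρ))
      ≤ k ^ 2 * mass (peak a k ρ) := by
  have hA := mul_nonneg hk.le hρ
  have h1 := le_mass_peak a hk hρ
  have h2 := three_mul_moment_deriv_w hA
  have h3 := w_sq_le_two (k * ρ)
  have h4 : mass (deriv (peak a k ρ)) - k ^ 2 / 3 * mass (peak a k ρ)
      = k ^ 2 * a ^ 2 * (w (k * ρ) ^ 2 / 6) := by
    rw [mass_peak a hk, mass_deriv_peak a hk]
    linear_combination (k ^ 2 * a ^ 2 / 3) * h2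
  rw [h4, abs_of_nonneg (by positivity)]
  calc k ^ 2 * a ^ 2 * (w (k * ρ) ^ 2 / 6) * (1 + 2 * (k * ρ))
      ≤ k ^ 2 * a ^ 2 * 1 * (1 + 2 * (k * ρ)) := by gcongr; linarith
    _ = k ^ 2 * (a ^ 2 * (1 + 2 * (k * ρ))) := by ring
    _ ≤ _ := by gcongr

/-- The points at distance at least `δ` from `ρ`. -/
def farSet (ρ δ : ℝ) : Set ℝ := {s | δ ≤ |s - ρ|}

theorem measurableSet_farSet (ρ δ : ℝ) : MeasurableSet (farSet ρ δ) :=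
  (isClosed_le continuous_const (by fun_prop)).measurableSet

/-- The part of the mass at distance at least `δ` from `ρ`. -/
def farMass (f : ℝ → ℝ) (ρ δ : ℝ) : ℝ :=
  ∫ r in Ioi (0 : ℝ), r * (farSet ρ δ).indicator (fun s => f s ^ 2) r

theorem farMass_peak_le (a : ℝ) {k ρ δ : ℝ} (hk : 0 < k) (hρ : 0 ≤ ρ) (hδ : 0 ≤ δ) :
    farMass (peak a k ρ) ρ δ ≤ 16 * Real.pi / (1 + k * δ) * mass (peak a k ρ) := by
  have hA := mul_nonneg hk.le hρ
  have h2 (r : ℝ) : r * (farSet ρ δ).indicator (fun s => peak a k ρ s ^ 2) r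
      = k ^ 2 * a ^ 2 * (r * ({y | k * δ ≤ |y|}.indicator fun y => w y ^ 2) (k * (r - ρ))) := by
    have hiff : r ∈ farSet ρ δ ↔ k * (r - ρ) ∈ {y : ℝ | k * δ ≤ |y|} := by
      simp [farSet, abs_mul, abs_of_pos hk, mul_le_mul_iff_right₀ hk]
    by_cases hr : r ∈ farSet ρ δ
    · rw [indicator_of_mem hr, indicator_of_mem (hiff.1 hr), peak]; ring
    · rw [indicator_of_notMem hr, indicator_of_notMem (fun h => hr (hiff.2 h))]; ring
  simp only [farMass, h2]
  rw [integral_const_mul, setIntegral_comp_eq_moment hk]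
  have h3 := moment_indicator_le hA (mul_nonneg hk.le hδ)
  have h4 := le_mass_peak a hk hρ
  have hpi := Real.pi_pos
  calc k ^ 2 * a ^ 2 * ((k ^ 2)⁻¹ * moment (k * ρ) ({y | k * δ ≤ |y|}.indicator fun y => w y ^ 2))
      = a ^ 2 * moment (k * ρ) ({y | k * δ ≤ |y|}.indicator fun y => w y ^ 2) := by field_simp
    _ ≤ a ^ 2 * (16 * Real.pi * (1 + k * ρ) / (1 + k * δ)) := by gcongr
    _ = 16 * Real.pi / (1 + k * δ) * (a ^ 2 * (1 + k * ρ)) := by ring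
    _ ≤ 16 * Real.pi / (1 + k * δ) * mass (peak a k ρ) := by
        gcongr
        exact le_trans (mul_le_mul_of_nonneg_left (by linarith) (sq_nonneg a)) h4

theorem FiniteEnergy.integrableOn_far {f : ℝ → ℝ} (hf : FiniteEnergy f) (ρ δ : ℝ) :
    IntegrableOn (fun r => r * (farSet ρ δ).indicator (fun s => f s ^ 2) r) (Ioi 0) := by
  have h := hf.integrableOn.indicator (measurableSet_farSet ρ δ)
  refine h.congr (ae_of_all _ fun r => ?_)
  by_cases hr : r ∈ farSet ρ δ
  · simp only [indicator_of_mem hr]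
  · simp only [indicator_of_notMem hr, mul_zero]

/-- A bounded continuous weight on top of `r f g`. -/
theorem integrableOn_weight_mul {f g c : ℝ → ℝ} (hf : Continuous f) (hg : Continuous g)
    (hif : IntegrableOn (fun r => r * f r ^ 2) (Ioi 0))
    (hig : IntegrableOn (fun r => r * g r ^ 2) (Ioi 0)) {C : ℝ}
    (hc : AEStronglyMeasurable c) (hC : ∀ r ∈ Ioi (0 : ℝ), |c r| ≤ C) :
    IntegrableOn (fun r => r * (c r * (f r * g r))) (Ioi 0) := by
  refine ((hif.add hig).const_mul C).mono' ?_ ?_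
  · exact (AEStronglyMeasurable.mul (by fun_prop) (hc.mul (by fun_prop))).restrict
  · refine (ae_restrict_iff' measurableSet_Ioi).2 (ae_of_all _ fun r hr => ?_)
    have hr0 : (0 : ℝ) < r := hr
    have h1 := hC r hr
    have h2 : |f r| * |g r| ≤ f r ^ 2 + g r ^ 2 := by
      nlinarith [sq_nonneg (|f r| - |g r|), sq_abs (f r), sq_abs (g r), sq_nonneg (f r),
        sq_nonneg (g r)]
    have hC0 : 0 ≤ C := (abs_nonneg _).trans h1
    rw [Real.norm_eq_abs, abs_mul, abs_mul, abs_mul, abs_of_pos hr0]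
    calc r * (|c r| * (|f r| * |g r|)) ≤ r * (C * (f r ^ 2 + g r ^ 2)) := by gcongr
      _ = _ := by simp only [Pi.add_apply]; ring

theorem FiniteEnergy.sub {f g : ℝ → ℝ} (hf : FiniteEnergy f) (hg : FiniteEnergy g) :
    FiniteEnergy (fun s => f s - g s) := by
  have key {f g : ℝ → ℝ} (hf : Continuous f) (hg : Continuous g)
      (hif : IntegrableOn (fun r => r * f r ^ 2) (Ioi 0))
      (hig : IntegrableOn (fun r => r * g r ^ 2) (Ioi 0)) :
      IntegrableOn (fun r => r * (f r - g r) ^ 2) (Ioi 0) := by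
    have h := (hif.add hig).sub ((integrableOn_weight_mul hf hg hif hig (c := fun _ => 1) (C := 1)
      (by fun_prop) (by simp)).const_mul 2)
    refine h.congr (ae_of_all _ fun r => ?_)
    simp only [Pi.add_apply, Pi.sub_apply]
    ring
  have hd : deriv (fun s => f s - g s) = fun s => deriv f s - deriv g s := funext fun s =>
    deriv_fun_sub (hf.contDiff.differentiable (by norm_num) s)
      (hg.contDiff.differentiable (by norm_num) s)
  refine ⟨hf.contDiff.sub hg.contDiff, key hf.contDiff.continuous hg.contDiff.continuous
    hf.integrableOn hg.integrableOn, ?_⟩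
  rw [hd]
  exact key (hf.contDiff.continuous_deriv le_rfl) (hg.contDiff.continuous_deriv le_rfl)
    hf.integrableOn_deriv hg.integrableOn_deriv

/-! ### Radial functions in polar coordinates -/

theorem single_eq_smul (r : ℝ) :
    (EuclideanSpace.single 0 r : Plane) = r • EuclideanSpace.single 0 (1 : ℝ) := by
  ext i; fin_cases i <;> simp

theorem profile_eq (f : Plane → ℝ) :
    profile f = fun r : ℝ => f (r • (EuclideanSpace.single 0 (1 : ℝ) : Plane)) := by
  funext r
  rw [profile, single_eq_smul]

theorem contDiff_profile {f : Plane → ℝ} {m : WithTop ℕ∞} (hf : ContDiff ℝ m f) :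
    ContDiff ℝ m (profile f) := by
  rw [profile_eq]
  exact hf.comp (contDiff_id.smul contDiff_const)

theorem IsRadial.eq_profile {f : Plane → ℝ} (hf : IsRadial f) (x : Plane) :
    f x = profile f ‖x‖ := by
  refine hf _ _ ?_
  simp

/-- The radial derivative is the derivative in the direction `x / |x|`. -/
theorem IsRadial.abs_deriv_profile_le {f : Plane → ℝ} (hf : IsRadial f) (hd : ContDiff ℝ 1 f)
    {x : Plane} (hx : x ≠ 0) : |deriv (profile f) ‖x‖| ≤ ‖fderiv ℝ f x‖ := by
  have hx' : 0 < ‖x‖ := norm_pos_iff.2 hx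
  set e : Plane := ‖x‖⁻¹ • x
  have he : ‖e‖ = 1 := by simp [e, norm_smul, hx'.ne']
  have hxe : ‖x‖ • e = x := by simp [e, smul_smul, hx'.ne']
  have h1 : profile f =ᶠ[𝓝 ‖x‖] fun r => f (r • e) := by
    filter_upwards [lt_mem_nhds hx'] with r hr
    rw [hf.eq_profile (r • e), norm_smul, he, mul_one, Real.norm_eq_abs, abs_of_pos hr]
  have h2 : HasDerivAt (fun r : ℝ => r • e) e ‖x‖ := by
    simpa using (hasDerivAt_id ‖x‖).smul_const e
  have h3 : HasFDerivAt f (fderiv ℝ f x) (‖x‖ • e) := by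
    rw [hxe]
    exact (hd.differentiable (by norm_num) x).hasFDerivAt
  have h4 : HasDerivAt (profile f) (fderiv ℝ f x e) ‖x‖ :=
    (h3.comp_hasDerivAt ‖x‖ h2).congr_of_eventuallyEq h1
  rw [h4.deriv, ← Real.norm_eq_abs]
  simpa [he] using (fderiv ℝ f x).le_opNorm e

theorem integrableOn_of_integrable_norm {g : ℝ → ℝ}
    (h : Integrable (fun x : Plane => g ‖x‖)) : IntegrableOn (fun r => r * g r) (Ioi 0) := by
  have := (integrable_fun_norm_addHaar (volume : Measure Plane)).1 h
  simpa [finrank_euclideanSpace] using this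

theorem finiteEnergy_profile {f : Plane → ℝ} (hr : IsRadial f) (hd : ContDiff ℝ 1 f)
    (hf : InH1 f) : FiniteEnergy (profile f) := by
  have hp := contDiff_profile hd
  refine ⟨hp, integrableOn_of_integrable_norm (g := fun r => profile f r ^ 2) ?_,
    integrableOn_of_integrable_norm (g := fun r => deriv (profile f) r ^ 2) ?_⟩
  · refine hf.1.integrable_sq.congr (ae_of_all _ fun x => ?_)
    simp only [hr.eq_profile x]
  · have hc := hp.continuous_deriv le_rfl
    refine (hf.2.norm.integrable_sq).mono' (by fun_prop) ?_
    have h0 : ∀ᵐ x : Plane, x ≠ 0 := by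
      simp [ae_iff]
    filter_upwards [h0] with x hx
    rw [Real.norm_eq_abs, abs_of_nonneg (sq_nonneg _), sq_le_sq]
    simpa using hr.abs_deriv_profile_le hd hx

theorem integral_sq_eq_mass {f : Plane → ℝ} (hr : IsRadial f) :
    ∫ x, f x ^ 2 = 2 * Real.pi * mass (profile f) := by
  have h := integral_fun_norm_addHaar (volume : Measure Plane) (fun r => profile f r ^ 2)
  have h1 (x : Plane) : f x ^ 2 = profile f ‖x‖ ^ 2 := by rw [hr.eq_profile x]
  simp only [h1, h, mass, finrank_euclideanSpace, Fintype.card_fin, Measure.real,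
    EuclideanSpace.volume_ball_fin_two]
  simp [Real.pi_nonneg]
  ring

theorem contDiff_deriv_of_contDiff_two {p : ℝ → ℝ} (hp : ContDiff ℝ 2 p) :
    ContDiff ℝ 1 (deriv p) := by
  have h : ContDiff ℝ (1 + 1) p := by rwa [one_add_one_eq_two]
  exact (contDiff_succ_iff_deriv.1 h).2.2

theorem hasDerivAt_fderiv_line {E : Type*} [NormedAddCommGroup E] [NormedSpace ℝ E] {f : E → ℝ}
    (hd : ContDiff ℝ 2 f) (x v : E) :
    HasDerivAt (fun s : ℝ => fderiv ℝ f (x + s • v) v) (fderiv ℝ (fderiv ℝ f) x v v) 0 := by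
  have hd2 : Differentiable ℝ (fderiv ℝ f) :=
    (hd.fderiv_right (m := 1) (by norm_num)).differentiable (by norm_num)
  have h1 : HasFDerivAt (fun y => fderiv ℝ f y v) ((fderiv ℝ (fderiv ℝ f) x).flip v) x := by
    have h := (hd2 x).hasFDerivAt.clm_apply (hasFDerivAt_const v x)
    refine h.congr_fderiv ?_
    ext y
    simp
  have h2 : HasDerivAt (fun s : ℝ => x + s • v) v 0 := by
    simpa using ((hasDerivAt_id (0 : ℝ)).smul_const v).const_add x
  have h3 := HasFDerivAt.comp_hasDerivAt (l := fun y => fderiv ℝ f y v)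
    (f := fun s : ℝ => x + s • v) (0 : ℝ) (by simpa using h1) h2
  have h4 : fderiv ℝ (fderiv ℝ f) x v v = (fderiv ℝ (fderiv ℝ f) x).flip v v := rfl
  rw [h4]
  exact h3

/-- The Laplacian of a radial function in polar coordinates. -/
theorem IsRadial.laplacian_eq {f : Plane → ℝ} (hf : IsRadial f) (hd : ContDiff ℝ 2 f)
    {r : ℝ} (hr : 0 < r) :
    Laplacian.laplacian f (EuclideanSpace.single 0 r)
      = deriv (deriv (profile f)) r + deriv (profile f) r / r := by
  set x : Plane := EuclideanSpace.single 0 r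
  have hd1 : Differentiable ℝ f := hd.differentiable (by norm_num)
  have hline (v : Plane) (t : ℝ) : HasDerivAt (fun s : ℝ => x + s • v) v t := by
    simpa using ((hasDerivAt_id t).smul_const v).const_add x
  have h1 (v : Plane) (t : ℝ) :
      HasDerivAt (fun s : ℝ => f (x + s • v)) (fderiv ℝ f (x + t • v) v) t :=
    (hd1 (x + t • v)).hasFDerivAt.comp_hasDerivAt t (hline v t)
  have h2 (v : Plane) :
      HasDerivAt (fun s : ℝ => fderiv ℝ f (x + s • v) v) (fderiv ℝ (fderiv ℝ f) x v v) 0 :=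
    hasDerivAt_fderiv_line hd x v
  have hp : ContDiff ℝ 2 (profile f) := contDiff_profile hd
  have hp1 (t : ℝ) : HasDerivAt (profile f) (deriv (profile f) t) t :=
    (hp.differentiable (by norm_num) t).hasDerivAt
  have hp2 (t : ℝ) : HasDerivAt (deriv (profile f)) (deriv (deriv (profile f)) t) t :=
    ((contDiff_deriv_of_contDiff_two hp).differentiable (by norm_num) t).hasDerivAt
  have e0 : fderiv ℝ (fderiv ℝ f) x (EuclideanSpace.single 0 1) (EuclideanSpace.single 0 1)
      = deriv (deriv (profile f)) r := by
    have hpt (s : ℝ) : x + s • (EuclideanSpace.single 0 1 : Plane)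
        = EuclideanSpace.single 0 (r + s) := by
      ext i; fin_cases i <;> simp [x]
    have h5 : (fun s : ℝ => f (x + s • (EuclideanSpace.single 0 1 : Plane)))
        = fun s => profile f (r + s) := by
      funext s; rw [hpt, profile]
    have h6 (t : ℝ) : fderiv ℝ f (x + t • (EuclideanSpace.single 0 1 : Plane))
        (EuclideanSpace.single 0 1) = deriv (profile f) (r + t) := by
      have := h1 (EuclideanSpace.single 0 1) t
      rw [h5] at this
      exact this.unique ((hp1 (r + t)).comp_const_add r t)
    have h7 := h2 (EuclideanSpace.single 0 1)
    simp only [h6] at h7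
    refine h7.unique ?_
    simpa using HasDerivAt.comp_const_add r (0 : ℝ) (by simpa using hp2 r)
  -- in the transversal direction `f` is `profile f (√(r² + s²))`, with derivative `s` times a
  -- function whose value at `s = 0` is `(profile f)'(r) / r`
  have e1 : fderiv ℝ (fderiv ℝ f) x (EuclideanSpace.single 1 1) (EuclideanSpace.single 1 1)
      = deriv (profile f) r / r := by
    have hnorm (s : ℝ) : ‖x + s • (EuclideanSpace.single 1 1 : Plane)‖ = √(r ^ 2 + s ^ 2) := by
      rw [EuclideanSpace.norm_eq]
      simp [x]
    have hpos (s : ℝ) : 0 < r ^ 2 + s ^ 2 := by positivity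
    have h5 : (fun s : ℝ => f (x + s • (EuclideanSpace.single 1 1 : Plane)))
        = fun s => profile f (√(r ^ 2 + s ^ 2)) := by
      funext s; rw [hf.eq_profile, hnorm]
    have hsq (t : ℝ) : HasDerivAt (fun s => √(r ^ 2 + s ^ 2)) (t / √(r ^ 2 + t ^ 2)) t := by
      have h := ((hasDerivAt_pow 2 t).const_add (r ^ 2)).sqrt (hpos t).ne'
      refine h.congr_deriv ?_
      have := (Real.sqrt_pos.2 (hpos t)).ne'
      push_cast
      rw [pow_one, mul_div_mul_left _ _ two_ne_zero]
    have h6 (t : ℝ) : fderiv ℝ f (x + t • (EuclideanSpace.single 1 1 : Plane))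
        (EuclideanSpace.single 1 1)
        = t * (deriv (profile f) (√(r ^ 2 + t ^ 2)) / √(r ^ 2 + t ^ 2)) := by
      have := h1 (EuclideanSpace.single 1 1) t
      rw [h5] at this
      have h' : HasDerivAt (fun s => profile f (√(r ^ 2 + s ^ 2)))
          (deriv (profile f) (√(r ^ 2 + t ^ 2)) * (t / √(r ^ 2 + t ^ 2))) t :=
        HasDerivAt.comp (h₂ := profile f) (h := fun s => √(r ^ 2 + s ^ 2)) t (hp1 _) (hsq t)
      refine (this.unique h').trans ?_
      ring
    have h7 := h2 (EuclideanSpace.single 1 1)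
    simp only [h6] at h7
    refine h7.unique ?_
    have h8 : √(r ^ 2 + (0 : ℝ) ^ 2) = r := by simp [hr.le]
    have h9 := (HasDerivAt.comp (h₂ := deriv (profile f)) (h := fun s => √(r ^ 2 + s ^ 2))
      0 (hp2 _) (hsq 0)).div (hsq 0) (by rw [h8]; exact hr.ne')
    have h10 := (hasDerivAt_id (0 : ℝ)).mul h9
    refine h10.congr_deriv ?_
    simp [hr.le]
  rw [InnerProductSpace.laplacian_eq_iteratedFDeriv_orthonormalBasis f
    (EuclideanSpace.basisFun (Fin 2) ℝ)]
  simp only [iteratedFDeriv_two_apply, EuclideanSpace.basisFun_apply, Fin.sum_univ_two,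
    Matrix.cons_val_zero, Matrix.cons_val_one]
  rw [e0, e1]

/-! ### The local Pohozaev identity -/

/-- The local Pohozaev identity with multiplier `ψ`. It comes from integrating the derivative of
`ψ E + ψ' (p p' + q q') / 4`, where `E` is the Hamiltonian of the system; the second term removes
all quartic terms, so that no bound on the coupling coefficients is needed. -/
theorem pohozaev_identity {p q A B ψ : ℝ → ℝ} {α β γ lam : ℝ}
    (hp : ContDiff ℝ 2 p) (hq : ContDiff ℝ 2 q) (hA : ContDiff ℝ 1 A) (hB : ContDiff ℝ 1 B)
    (hψ : ContDiff ℝ 2 ψ) (hψc : HasCompactSupport ψ) (hψ0 : ψ 0 = 0) (hψ0' : deriv ψ 0 = 0)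
    (eqp : ∀ r, 0 < r → deriv (deriv p) r + deriv p r / r
      = (lam + A r) * p r - α * p r ^ 3 - β * p r * q r ^ 2)
    (eqq : ∀ r, 0 < r → deriv (deriv q) r + deriv q r / r
      = (lam + B r) * q r - γ * q r ^ 3 - β * p r ^ 2 * q r) :
    ∫ r in Ioi (0 : ℝ), (deriv ψ r * (3 / 4 * (deriv p r ^ 2 + deriv q r ^ 2)
        - 1 / 4 * ((lam + A r) * p r ^ 2 + (lam + B r) * q r ^ 2))
      + 1 / 4 * (deriv (deriv ψ) r - deriv ψ r / r) * (p r * deriv p r + q r * deriv q r)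
      - ψ r * ((deriv p r ^ 2 + deriv q r ^ 2) / r
        + 1 / 2 * (deriv A r * p r ^ 2 + deriv B r * q r ^ 2))) = 0 := by
  have hp' := contDiff_deriv_of_contDiff_two hp
  have hq' := contDiff_deriv_of_contDiff_two hq
  have hψ' := contDiff_deriv_of_contDiff_two hψ
  have hp1 : ContDiff ℝ 1 p := hp.of_le (by norm_num)
  have hq1 : ContDiff ℝ 1 q := hq.of_le (by norm_num)
  have hψ1 : ContDiff ℝ 1 ψ := hψ.of_le (by norm_num)
  have d {f : ℝ → ℝ} (hf : ContDiff ℝ 1 f) (r : ℝ) : HasDerivAt f (deriv f r) r :=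
    (hf.differentiable (by norm_num) r).hasDerivAt
  set G : ℝ → ℝ := fun r => ψ r * (1 / 2 * (deriv p r ^ 2 + deriv q r ^ 2)
      - 1 / 2 * ((lam + A r) * p r ^ 2 + (lam + B r) * q r ^ 2)
      + 1 / 4 * (α * p r ^ 4 + 2 * β * (p r ^ 2 * q r ^ 2) + γ * q r ^ 4))
    + 1 / 4 * (deriv ψ r * (p r * deriv p r + q r * deriv q r)) with hG
  have hGc : ContDiff ℝ 1 G := by fun_prop
  have hGs : HasCompactSupport G := hψc.mul_right.add
    ((hψc.deriv.mul_right (f' := fun r => p r * deriv p r + q r * deriv q r)).mul_left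
      (f := fun _ => 1 / 4))
  have h := hGs.integral_Ioi_deriv_eq hGc 0
  have hG0 : G 0 = 0 := by simp [hG, hψ0, hψ0']
  rw [hG0, neg_zero] at h
  refine Eq.trans ?_ h
  refine setIntegral_congr_fun measurableSet_Ioi fun r hr => ?_
  have hr0 : (0 : ℝ) < r := hr
  have ep := eqp r hr
  have eq := eqq r hr
  have hdG := ((d hψ1 r).mul (((((d hp' r).pow 2).add ((d hq' r).pow 2)).const_mul (1 / 2)
      |>.sub (((((d hA r).const_add lam).mul ((d hp1 r).pow 2)).add
        (((d hB r).const_add lam).mul ((d hq1 r).pow 2))).const_mul (1 / 2))).add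
      (((((d hp1 r).pow 4).const_mul α).add ((((d hp1 r).pow 2).mul
        ((d hq1 r).pow 2)).const_mul (2 * β))).add (((d hq1 r).pow 4).const_mul γ)
        |>.const_mul (1 / 4)))).add
    (((d hψ' r).mul (((d hp1 r).mul (d hp' r)).add ((d hq1 r).mul (d hq' r)))).const_mul (1 / 4))
  have hdG' : deriv G r = _ := hdG.deriv
  rw [hdG']
  simp only [Pi.add_apply, Pi.mul_apply, Pi.pow_apply, Pi.sub_apply]
  rw [show deriv (deriv p) r = (lam + A r) * p r - α * p r ^ 3 - β * p r * q r ^ 2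
      - deriv p r / r by linarith,
    show deriv (deriv q) r = (lam + B r) * q r - γ * q r ^ 3 - β * p r ^ 2 * q r
      - deriv q r / r by linarith]
  push_cast
  ring

/-- A smooth cutoff, equal to `1` on `[-2, 2]` and to `0` outside `(-3, 3)`. -/
def cutoff : ContDiffBump (0 : ℝ) := ⟨2, 3, by norm_num, by norm_num⟩

theorem contDiff_cutoff : ContDiff ℝ 2 cutoff := cutoff.contDiff

/-- Weight of the gradient term in the Pohozaev identity with multiplier `r² χ(r / R)`. -/
def gradWeight (t : ℝ) : ℝ := cutoff t + 3 / 2 * (t * deriv cutoff t)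

/-- Weight of the potential term in the Pohozaev identity with multiplier `r² χ(r / R)`. -/
def potWeight (t : ℝ) : ℝ := cutoff t + 1 / 2 * (t * deriv cutoff t)

/-- Weight of the mixed term in the Pohozaev identity with multiplier `r² χ(r / R)`. -/
def crossWeight (t : ℝ) : ℝ := 1 / 2 * (3 * deriv cutoff t + t * deriv (deriv cutoff) t)

theorem continuous_deriv_cutoff : Continuous (deriv cutoff) :=
  (contDiff_deriv_of_contDiff_two contDiff_cutoff).continuous

theorem continuous_deriv_deriv_cutoff : Continuous (deriv (deriv cutoff)) :=
  (contDiff_deriv_of_contDiff_two contDiff_cutoff).continuous_deriv le_rfl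

theorem continuous_gradWeight : Continuous gradWeight := by
  have := continuous_deriv_cutoff
  have := contDiff_cutoff.continuous
  unfold gradWeight
  fun_prop

theorem continuous_potWeight : Continuous potWeight := by
  have := continuous_deriv_cutoff
  have := contDiff_cutoff.continuous
  unfold potWeight
  fun_prop

theorem continuous_crossWeight : Continuous crossWeight := by
  have := continuous_deriv_cutoff
  have := continuous_deriv_deriv_cutoff
  unfold crossWeight
  fun_prop

theorem weights_bounded :
    ∃ c, 1 ≤ c ∧ ∀ t, |gradWeight t| ≤ c ∧ |potWeight t| ≤ c ∧ |crossWeight t| ≤ c := by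
  have hs : HasCompactSupport cutoff := cutoff.hasCompactSupport
  have hs1 : HasCompactSupport (fun t => t * deriv cutoff t) := hs.deriv.mul_left
  have hg : HasCompactSupport gradWeight :=
    hs.add (hs1.mul_left (f := fun _ => 3 / 2))
  have hp : HasCompactSupport potWeight :=
    hs.add (hs1.mul_left (f := fun _ => 1 / 2))
  have hc : HasCompactSupport crossWeight :=
    ((hs.deriv.mul_left (f := fun _ => 3)).add
      (hs.deriv.deriv.mul_left (f := fun t => t))).mul_left (f := fun _ => 1 / 2)
  obtain ⟨a, ha⟩ := hg.exists_bound_of_continuous continuous_gradWeight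
  obtain ⟨b, hb⟩ := hp.exists_bound_of_continuous continuous_potWeight
  obtain ⟨c, hc⟩ := hc.exists_bound_of_continuous continuous_crossWeight
  refine ⟨max 1 (max a (max b c)), le_max_left _ _, fun t => ⟨?_, ?_, ?_⟩⟩
  · exact (ha t).trans (by simp)
  · exact (hb t).trans (by simp)
  · exact (hc t).trans (by simp)

theorem cutoff_eventuallyEq_one {t : ℝ} (ht : |t| < 2) : (cutoff : ℝ → ℝ) =ᶠ[𝓝 t] fun _ => 1 :=
  cutoff.eventuallyEq_one_of_mem_ball (by simpa [cutoff] using ht)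

theorem weights_of_abs_lt {t : ℝ} (ht : |t| < 2) :
    cutoff t = 1 ∧ gradWeight t = 1 ∧ potWeight t = 1 ∧ crossWeight t = 0 := by
  have h0 := (cutoff_eventuallyEq_one ht).eq_of_nhds
  have h1 := (cutoff_eventuallyEq_one ht).deriv_eq
  have h2 := (cutoff_eventuallyEq_one ht).deriv.deriv_eq
  simp only [deriv_const] at h1
  simp only [deriv_const', deriv_const] at h2
  simp [gradWeight, potWeight, crossWeight, h0, h1, h2]

theorem abs_mul_cutoff_le (t : ℝ) : |t * cutoff t| ≤ 3 := by
  rw [abs_mul, abs_of_nonneg cutoff.nonneg]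
  rcases le_or_gt 3 |t| with h | h
  · rw [cutoff.zero_of_le_dist (by simpa [cutoff] using h)]
    simp
  · have := cutoff.le_one (x := t)
    nlinarith [abs_nonneg t, cutoff.nonneg (x := t)]

/-- The quadratic form of one component on the energy side of the Pohozaev identity; it is
`f'² - (lam + A) f²` for `|r| < 2 R`. -/
def energyForm (A : ℝ → ℝ) (lam R : ℝ) (f : ℝ → ℝ) (r : ℝ) : ℝ :=
  gradWeight (r / R) * deriv f r ^ 2 - potWeight (r / R) * (lam + A r) * f r ^ 2
    + crossWeight (r / R) / R * (f r * deriv f r)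

/-- The quadratic form of one component on the potential side of the Pohozaev identity: it is
`r χ(r / R) A'(r) f(r)²`, written in terms of the bounded function `t χ(t)`. -/
def virialForm (A : ℝ → ℝ) (R : ℝ) (f : ℝ → ℝ) (r : ℝ) : ℝ :=
  R * (r / R * cutoff (r / R)) * deriv A r * f r ^ 2

theorem FiniteEnergy.integrableOn_energyForm {f A : ℝ → ℝ} (hf : FiniteEnergy f)
    (hA : Continuous A) {C : ℝ} (hC : ∀ r, |A r| ≤ C) (lam R : ℝ) :
    IntegrableOn (fun r => r * energyForm A lam R f r) (Ioi 0) := by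
  obtain ⟨c, hc1, hc⟩ := weights_bounded
  have hfc := hf.contDiff.continuous
  have hfc' := hf.contDiff.continuous_deriv le_rfl
  have hg := continuous_gradWeight
  have hp := continuous_potWeight
  have hx := continuous_crossWeight
  have h1 := integrableOn_weight_mul hfc' hfc' hf.integrableOn_deriv hf.integrableOn_deriv
    (c := fun r => gradWeight (r / R)) (C := c) (by fun_prop) fun r _ => (hc _).1
  have h2 := integrableOn_weight_mul hfc hfc hf.integrableOn hf.integrableOn
    (c := fun r => potWeight (r / R) * (lam + A r)) (C := c * (|lam| + C)) (by fun_prop)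
    fun r _ => by
      rw [abs_mul]
      exact mul_le_mul (hc _).2.1 ((abs_add_le _ _).trans (by gcongr; exact hC r))
        (abs_nonneg _) (by linarith)
  have h3 := integrableOn_weight_mul hfc hfc' hf.integrableOn hf.integrableOn_deriv
    (c := fun r => crossWeight (r / R) / R) (C := c / |R|) (by fun_prop)
    fun r _ => by
      rw [abs_div]
      gcongr
      exact (hc _).2.2
  refine ((h1.sub h2).add h3).congr (ae_of_all _ fun r => ?_)
  simp only [Pi.add_apply, Pi.sub_apply, energyForm]
  ring

theorem FiniteEnergy.integrableOn_virialForm {f A : ℝ → ℝ} (hf : FiniteEnergy f)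
    (hA : Continuous (deriv A)) {C : ℝ} (hC : ∀ r, |deriv A r| ≤ C) (R : ℝ) :
    IntegrableOn (fun r => r * virialForm A R f r) (Ioi 0) := by
  have hfc := hf.contDiff.continuous
  have hχ := contDiff_cutoff.continuous
  have h2 := integrableOn_weight_mul hfc hfc hf.integrableOn hf.integrableOn
    (c := fun r => R * (r / R * cutoff (r / R)) * deriv A r) (C := |R| * 3 * C) (by fun_prop)
    fun r _ => by
      rw [abs_mul, abs_mul]
      have := abs_mul_cutoff_le (r / R)
      gcongr
      exact hC r
  refine h2.congr (ae_of_all _ fun r => ?_)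
  simp only [virialForm]
  ring

/-- The Pohozaev identity with multiplier `r² χ(r / R)`, split into the two components. -/
theorem energyForm_eq_virialForm {p q A B : ℝ → ℝ} {α β γ lam C R : ℝ} (hR : 0 < R)
    (hp : ContDiff ℝ 2 p) (hq : ContDiff ℝ 2 q) (hA : ContDiff ℝ 1 A) (hB : ContDiff ℝ 1 B)
    (hpe : FiniteEnergy p) (hqe : FiniteEnergy q)
    (hAC : ∀ r, |A r| ≤ C) (hBC : ∀ r, |B r| ≤ C)
    (hAC' : ∀ r, |deriv A r| ≤ C) (hBC' : ∀ r, |deriv B r| ≤ C)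
    (eqp : ∀ r, 0 < r → deriv (deriv p) r + deriv p r / r
      = (lam + A r) * p r - α * p r ^ 3 - β * p r * q r ^ 2)
    (eqq : ∀ r, 0 < r → deriv (deriv q) r + deriv q r / r
      = (lam + B r) * q r - γ * q r ^ 3 - β * p r ^ 2 * q r) :
    (∫ r in Ioi (0 : ℝ), r * energyForm A lam R p r)
        + (∫ r in Ioi (0 : ℝ), r * energyForm B lam R q r)
      = (∫ r in Ioi (0 : ℝ), r * virialForm A R p r)
        + ∫ r in Ioi (0 : ℝ), r * virialForm B R q r := by
  have hχ := contDiff_cutoff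
  have hχ' := contDiff_deriv_of_contDiff_two hχ
  have d {f : ℝ → ℝ} (hf : ContDiff ℝ 1 f) (r : ℝ) : HasDerivAt f (deriv f r) r :=
    (hf.differentiable (by norm_num) r).hasDerivAt
  have dR {f : ℝ → ℝ} (hf : ContDiff ℝ 1 f) (r : ℝ) :
      HasDerivAt (fun s => f (s / R)) (deriv f (r / R) * (1 / R)) r :=
    HasDerivAt.comp (h₂ := f) (h := fun s => s / R) r (d hf _) ((hasDerivAt_id r).div_const R)
  set ψ : ℝ → ℝ := fun r => r ^ 2 * cutoff (r / R) with hψ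
  have hψ1 : deriv ψ = fun r => 2 * r * cutoff (r / R) + r ^ 2 * (deriv cutoff (r / R) / R) := by
    funext r
    have h := ((hasDerivAt_pow 2 r).mul (dR (hχ.of_le (by norm_num)) r)).deriv
    refine (show deriv ψ r = _ from h).trans ?_
    push_cast
    ring
  have hψ2 : deriv (deriv ψ) = fun r => 2 * cutoff (r / R) + 4 * r * (deriv cutoff (r / R) / R)
      + r ^ 2 * (deriv (deriv cutoff) (r / R) / R ^ 2) := by
    funext r
    rw [hψ1]
    have h := ((((hasDerivAt_id r).const_mul 2).mul (dR (hχ.of_le (by norm_num)) r)).add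
      ((hasDerivAt_pow 2 r).mul ((dR hχ' r).div_const R))).deriv
    refine (show _ = _ from h).trans ?_
    simp only [id]
    push_cast
    field_simp
    ring
  have hψc : HasCompactSupport ψ := by
    refine HasCompactSupport.intro (isCompact_Icc (a := -(3 * R)) (b := 3 * R)) fun r hr => ?_
    have h : 3 ≤ |r / R| := by
      rw [abs_div, abs_of_pos hR, le_div_iff₀ hR]
      by_contra! hcon
      exact hr (abs_le.1 hcon.le)
    simp only [hψ]
    rw [cutoff.zero_of_le_dist (by simpa only [dist_zero_right, Real.norm_eq_abs, cutoff] using h),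
      mul_zero]
  have key := pohozaev_identity hp hq hA hB (ψ := ψ) (by fun_prop) hψc (by simp [hψ])
    (by simp [hψ1]) eqp eqq
  have i1 := hpe.integrableOn_energyForm hA.continuous hAC lam R
  have i2 := hqe.integrableOn_energyForm hB.continuous hBC lam R
  have i3 := hpe.integrableOn_virialForm (hA.continuous_deriv le_rfl) hAC' R
  have i4 := hqe.integrableOn_virialForm (hB.continuous_deriv le_rfl) hBC' R
  have h2 := congrArg (fun x => 2 * x) key
  simp only [mul_zero] at h2
  rw [← integral_const_mul] at h2
  refine sub_eq_zero.1 (Eq.trans ?_ h2)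
  rw [← integral_add i1 i2, ← integral_add i3 i4]
  refine (integral_sub (i1.add i2) (i3.add i4)).symm.trans ?_
  refine setIntegral_congr_fun measurableSet_Ioi fun r hr => ?_
  have hr0 : r ≠ 0 := ne_of_gt hr
  rw [hψ2, hψ1]
  simp only [energyForm, virialForm, gradWeight, potWeight, crossWeight, hψ, Pi.add_apply]
  field_simp
  ring

/-! ### Stability of the Pohozaev identity near a peak -/

/-- The energy `∫₀^∞ r (f'² + lam f²) dr`. -/
def energy (lam : ℝ) (f : ℝ → ℝ) : ℝ := mass (deriv f) + lam * mass f

theorem energy_nonneg {lam : ℝ} (hlam : 0 ≤ lam) (f : ℝ → ℝ) : 0 ≤ energy lam f :=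
  add_nonneg (mass_nonneg _) (mul_nonneg hlam (mass_nonneg _))

theorem FiniteEnergy.integrableOn_energy {f : ℝ → ℝ} (hf : FiniteEnergy f) (lam : ℝ) :
    IntegrableOn (fun r => r * (deriv f r ^ 2 + lam * f r ^ 2)) (Ioi 0) :=
  (hf.integrableOn_deriv.add (hf.integrableOn.const_mul lam)).congr (ae_of_all _ fun r => by
    simp only [Pi.add_apply]; ring)

theorem FiniteEnergy.energy_eq {f : ℝ → ℝ} (hf : FiniteEnergy f) (lam : ℝ) :
    energy lam f = ∫ r in Ioi (0 : ℝ), r * (deriv f r ^ 2 + lam * f r ^ 2) := by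
  rw [energy, mass, mass, ← integral_const_mul,
    ← integral_add hf.integrableOn_deriv (hf.integrableOn.const_mul lam)]
  refine integral_congr_ae (ae_of_all _ fun r => ?_)
  simp only
  ring

/-- The weighted norm with a bounded potential is comparable to the energy. -/
theorem FiniteEnergy.normSq_bounds {f : ℝ → ℝ} (hf : FiniteEnergy f) {P : Plane → ℝ} {C lam : ℝ}
    (hP : Continuous (profile P)) (hC : ∀ r, |profile P r| ≤ C) (hlam : 2 * C ≤ lam) :
    energy lam f ≤ 2 * normSq P lam f ∧ normSq P lam f ≤ 2 * energy lam f := by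
  have hi : IntegrableOn (fun r => r * (deriv f r ^ 2 + (lam + profile P r) * f r ^ 2))
      (Ioi 0) := by
    have hc := hf.contDiff.continuous
    have h := integrableOn_weight_mul hc hc hf.integrableOn hf.integrableOn
      (c := profile P) (by fun_prop) fun r _ => hC r
    refine ((hf.integrableOn_energy lam).add h).congr (ae_of_all _ fun r => ?_)
    simp only [Pi.add_apply]
    ring
  have hi2 := hf.integrableOn_energy lam
  rw [hf.energy_eq, normSq, ← integral_const_mul, ← integral_const_mul]
  constructor
  · refine setIntegral_mono_on hi2 (hi.const_mul 2) measurableSet_Ioi fun r hr => ?_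
    have hr0 : (0 : ℝ) < r := hr
    have := abs_le.1 (hC r)
    rw [mul_left_comm]
    gcongr
    nlinarith [sq_nonneg (deriv f r), sq_nonneg (f r)]
  · refine setIntegral_mono_on hi (hi2.const_mul 2) measurableSet_Ioi fun r hr => ?_
    have hr0 : (0 : ℝ) < r := hr
    have := abs_le.1 (hC r)
    rw [mul_left_comm]
    gcongr
    nlinarith [sq_nonneg (deriv f r), sq_nonneg (f r)]

theorem abs_add_sq_sub_sq_le {η : ℝ} (hη : 0 < η) (hη1 : η ≤ 1) (x h : ℝ) :
    |(x + h) ^ 2 - x ^ 2| ≤ η * x ^ 2 + 2 / η * h ^ 2 := by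
  have h1 : |x * h| * 2 ≤ η * x ^ 2 + 1 / η * h ^ 2 := by
    have h2 : 0 ≤ (η * |x| - |h|) ^ 2 / η := by positivity
    have h3 : (η * |x| - |h|) ^ 2 / η = η * x ^ 2 + 1 / η * h ^ 2 - |x * h| * 2 := by
      rw [abs_mul, ← sq_abs x, ← sq_abs h]
      field_simp
      ring
    linarith
  have h4 : h ^ 2 ≤ 1 / η * h ^ 2 := le_mul_of_one_le_left (sq_nonneg h) (one_le_one_div hη hη1)
  have h5 : 2 / η * h ^ 2 = 1 / η * h ^ 2 + 1 / η * h ^ 2 := by ring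
  have h6 : (x + h) ^ 2 - x ^ 2 = 2 * (x * h) + h ^ 2 := by ring
  rw [h6]
  refine (abs_add_le _ _).trans ?_
  rw [abs_mul, abs_of_pos (two_pos : (0 : ℝ) < 2), abs_of_nonneg (sq_nonneg h)]
  linarith

theorem abs_setIntegral_sub_le {F G H : ℝ → ℝ} (hF : IntegrableOn F (Ioi 0))
    (hG : IntegrableOn G (Ioi 0)) (hH : IntegrableOn H (Ioi 0))
    (h : ∀ r ∈ Ioi (0 : ℝ), |F r - G r| ≤ H r) :
    |(∫ r in Ioi (0 : ℝ), F r) - ∫ r in Ioi (0 : ℝ), G r| ≤ ∫ r in Ioi (0 : ℝ), H r := by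
  rw [← integral_sub hF hG, ← Real.norm_eq_abs]
  exact norm_integral_le_of_norm_le hH ((ae_restrict_iff' measurableSet_Ioi).2
    (ae_of_all _ fun r hr => h r hr))

theorem div_max_one_lt_two {r ρ : ℝ} (hr : 0 < r) (h : r ∉ farSet ρ 1) :
    |r / max 1 ρ| < 2 := by
  have hR : 0 < max 1 ρ := lt_of_lt_of_le one_pos (le_max_left _ _)
  have h1 : |r - ρ| < 1 := by simpa [farSet] using h
  have := (abs_lt.1 h1).2
  rw [abs_div, abs_of_pos hr, abs_of_pos hR, div_lt_iff₀ hR]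
  linarith [le_max_left 1 ρ, le_max_right 1 ρ]

/-- Pointwise form of `energyForm_stability` where the cutoff equals `1`: `x`, `x'` are the values
of the peak and its derivative, and `h`, `h'` those of the perturbation. -/
theorem abs_energy_sub_le_of_near {x x' h h' A lam C η c : ℝ} (hlam : 0 < lam)
    (hlamC : 2 * C ≤ lam) (hC0 : 0 ≤ C) (hA : |A| ≤ C) (hη : 0 < η) (hη1 : η ≤ 1) (hc1 : 1 ≤ c) :
    |(x' + h') ^ 2 - (lam + A) * (x + h) ^ 2 - (x' ^ 2 - lam * x ^ 2)|
      ≤ (η + 2 * C / lam) * (x' ^ 2 + lam * x ^ 2) + 6 * c / η * (h' ^ 2 + lam * h ^ 2) := by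
  have hη' : 1 ≤ 1 / η := one_le_one_div hη hη1
  have q1 := abs_add_sq_sub_sq_le hη hη1 x' h'
  have q2 := abs_add_sq_sub_sq_le hη hη1 x h
  have q3 : |A * (x + h) ^ 2| ≤ 2 * C / lam * (lam * x ^ 2 + lam * h ^ 2) := by
    rw [abs_mul, abs_of_nonneg (sq_nonneg (x + h))]
    have h1 : (x + h) ^ 2 ≤ 2 * (x ^ 2 + h ^ 2) := by nlinarith [sq_nonneg (x - h)]
    calc |A| * (x + h) ^ 2 ≤ C * (2 * (x ^ 2 + h ^ 2)) := by gcongr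
      _ = _ := by field_simp
  have q4 : 2 * C / lam ≤ 1 := (div_le_one hlam).2 hlamC
  have q5 : 0 ≤ 2 * C / lam := by positivity
  have q6 : |lam * ((x + h) ^ 2 - x ^ 2)| ≤ lam * (η * x ^ 2 + 2 / η * h ^ 2) := by
    rw [abs_mul, abs_of_pos hlam]
    exact mul_le_mul_of_nonneg_left q2 hlam.le
  have e : (x' + h') ^ 2 - (lam + A) * (x + h) ^ 2 - (x' ^ 2 - lam * x ^ 2)
      = ((x' + h') ^ 2 - x' ^ 2) - lam * ((x + h) ^ 2 - x ^ 2) - A * (x + h) ^ 2 := by ring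
  rw [e]
  have hN : 0 ≤ h' ^ 2 + lam * h ^ 2 := by positivity
  have q7 : 3 / η * (h' ^ 2 + lam * h ^ 2) ≤ 6 * c / η * (h' ^ 2 + lam * h ^ 2) := by
    gcongr; linarith
  have q8 : 2 * C / lam * (lam * h ^ 2) ≤ 1 / η * (h' ^ 2 + lam * h ^ 2) :=
    mul_le_mul (q4.trans hη') (le_add_of_nonneg_left (sq_nonneg h')) (by positivity)
      (by positivity)
  have q9 : 0 ≤ 2 * C / lam * x' ^ 2 := by positivity
  have q10 := abs_sub ((x' + h') ^ 2 - x' ^ 2 - lam * ((x + h) ^ 2 - x ^ 2)) (A * (x + h) ^ 2)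
  have q11 := abs_sub ((x' + h') ^ 2 - x' ^ 2) (lam * ((x + h) ^ 2 - x ^ 2))
  have e5 : 3 / η * (h' ^ 2 + lam * h ^ 2) = 2 / η * h' ^ 2
    + lam * (2 / η * h ^ 2) + 1 / η * (h' ^ 2 + lam * h ^ 2) := by ring
  linarith

/-- Pointwise form of `energyForm_stability` away from the peak, where the weights are only known
to be bounded and nothing is gained from cancellation. -/
theorem abs_energy_sub_le_of_far {x x' h h' A lam C η c g₁ g₂ g₃ R : ℝ} (hlam : 1 ≤ lam)
    (hlamC : 2 * C ≤ lam) (hC0 : 0 ≤ C) (hA : |A| ≤ C) (hη : 0 < η) (hη1 : η ≤ 1) (hc1 : 1 ≤ c)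
    (hg₁ : |g₁| ≤ c) (hg₂ : |g₂| ≤ c) (hg₃ : |g₃| ≤ c) (hR : 1 ≤ R)
    (hx : x' ^ 2 ≤ 2 * lam * x ^ 2) :
    |g₁ * (x' + h') ^ 2 - g₂ * (lam + A) * (x + h) ^ 2 + g₃ / R * ((x + h) * (x' + h'))
        - (x' ^ 2 + -lam * x ^ 2)|
      ≤ (η + 2 * C / lam) * (x' ^ 2 + lam * x ^ 2) + 6 * c / η * (h' ^ 2 + lam * h ^ 2)
        + 21 * c * lam * x ^ 2 := by
  have hlam0 : 0 < lam := by linarith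
  have hA' := abs_le.1 hA
  have hNh : 0 ≤ h' ^ 2 + lam * h ^ 2 := by positivity
  have hNx : 0 ≤ x' ^ 2 + lam * x ^ 2 := by positivity
  have t1 : |g₁ * (x' + h') ^ 2| ≤ c * (x' + h') ^ 2 := by
    rw [abs_mul, abs_of_nonneg (sq_nonneg (x' + h'))]
    gcongr
  have t2 : |g₂ * (lam + A) * (x + h) ^ 2| ≤ c * (2 * lam) * (x + h) ^ 2 := by
    rw [abs_mul, abs_mul, abs_of_nonneg (sq_nonneg (x + h))]
    gcongr
    exact abs_le.2 ⟨by linarith, by linarith⟩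
  have t3 : |g₃ / R * ((x + h) * (x' + h'))| ≤ c * ((x' + h') ^ 2 + lam * (x + h) ^ 2) := by
    rw [abs_mul, abs_div, abs_of_pos (zero_lt_one.trans_le hR)]
    have s1 : |g₃| / R ≤ c := (div_le_self (abs_nonneg _) hR).trans hg₃
    have s2 : |(x + h) * (x' + h')| ≤ (x' + h') ^ 2 + lam * (x + h) ^ 2 := by
      have s3 : |x + h| * |x' + h'| ≤ |x' + h'| ^ 2 + |x + h| ^ 2 := by
        nlinarith [sq_nonneg (|x + h| - |x' + h'|), sq_nonneg |x + h|, sq_nonneg |x' + h'|]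
      have s4 : (x + h) ^ 2 ≤ lam * (x + h) ^ 2 := le_mul_of_one_le_left (sq_nonneg _) hlam
      rw [abs_mul]
      rw [sq_abs, sq_abs] at s3
      linarith
    exact mul_le_mul s1 s2 (abs_nonneg _) (by linarith)
  have b1 : |g₁ * (x' + h') ^ 2 - g₂ * (lam + A) * (x + h) ^ 2
      + g₃ / R * ((x + h) * (x' + h'))| ≤ 3 * c * ((x' + h') ^ 2 + lam * (x + h) ^ 2) := by
    have := abs_add_le (g₁ * (x' + h') ^ 2 - g₂ * (lam + A) * (x + h) ^ 2)
      (g₃ / R * ((x + h) * (x' + h')))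
    have := abs_sub (g₁ * (x' + h') ^ 2) (g₂ * (lam + A) * (x + h) ^ 2)
    have : 0 ≤ c * (x' + h') ^ 2 := by positivity
    linarith
  have b2 : (x' + h') ^ 2 + lam * (x + h) ^ 2 ≤ 2 * (x' ^ 2 + lam * x ^ 2)
      + 2 * (h' ^ 2 + lam * h ^ 2) := by
    have := sq_nonneg (x' - h')
    have := mul_nonneg hlam0.le (sq_nonneg (x - h))
    linarith
  have b3 : |x' ^ 2 + -lam * x ^ 2| ≤ x' ^ 2 + lam * x ^ 2 := by
    refine (abs_add_le _ _).trans (le_of_eq ?_)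
    rw [abs_of_nonneg (sq_nonneg _), abs_mul, abs_neg, abs_of_pos hlam0,
      abs_of_nonneg (sq_nonneg _)]
  have b5 : 6 * c * (h' ^ 2 + lam * h ^ 2) ≤ 6 * c / η * (h' ^ 2 + lam * h ^ 2) := by
    refine mul_le_mul_of_nonneg_right ?_ hNh
    rw [le_div_iff₀ hη]
    exact mul_le_of_le_one_right (by linarith) hη1
  have b6 : 0 ≤ (η + 2 * C / lam) * (x' ^ 2 + lam * x ^ 2) := by positivity
  have b7 : 7 * c * (x' ^ 2 + lam * x ^ 2) ≤ 7 * c * (3 * lam * x ^ 2) :=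
    mul_le_mul_of_nonneg_left (by linarith) (by linarith)
  have b8 : 3 * c * ((x' + h') ^ 2 + lam * (x + h) ^ 2)
      ≤ 3 * c * (2 * (x' ^ 2 + lam * x ^ 2) + 2 * (h' ^ 2 + lam * h ^ 2)) :=
    mul_le_mul_of_nonneg_left b2 (by linarith)
  have b9 : x' ^ 2 + lam * x ^ 2 ≤ c * (x' ^ 2 + lam * x ^ 2) := le_mul_of_one_le_left hNx hc1
  refine (abs_sub _ _).trans ?_
  linarith

/-- Energy side of the Pohozaev identity: for a perturbation `f` of a peak `U` it is
`∫ r (U'² - lam U²)`, up to a small multiple of the energy of the peak. The cutoff is invisible near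
the peak, and the peak carries little mass elsewhere. -/
theorem energyForm_stability : ∃ K : ℝ, 0 ≤ K ∧ ∀ {A f : ℝ → ℝ} {a k ρ lam C η : ℝ},
    Continuous A → (∀ r, |A r| ≤ C) → FiniteEnergy f → 0 < k → 0 ≤ ρ → 1 ≤ lam → 2 * C ≤ lam →
    k ^ 2 = lam + A ρ → 0 < η → η ≤ 1 →
    |(∫ r in Ioi (0 : ℝ), r * energyForm A lam (max 1 ρ) f r)
        - (mass (deriv (peak a k ρ)) - lam * mass (peak a k ρ))|
      ≤ K * (η + C / lam + 1 / k) * (lam * mass (peak a k ρ))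
        + K / η * energy lam (fun s => f s - peak a k ρ s) := by
  obtain ⟨c, hc1, hc⟩ := weights_bounded
  -- `1344 = 21 * 64`, from `abs_energy_sub_le_of_far` and the bound on the mass away from the peak
  refine ⟨1344 * c, by linarith, ?_⟩
  intro A f a k ρ lam C η hA hAC hf hk hρ hlam1 hlamC hk2 hη hη1
  set R := max 1 ρ with hRdef
  have hR : 1 ≤ R := le_max_left _ _
  set U := peak a k ρ with hU
  set ω : ℝ → ℝ := fun s => f s - U s with hω
  have hUe : FiniteEnergy U := finiteEnergy_peak a hk hρ
  have hωe : FiniteEnergy ω := hf.sub hUe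
  have hC0 : 0 ≤ C := (abs_nonneg _).trans (hAC 0)
  have hlam0 : 0 < lam := by linarith
  have hf1 (r : ℝ) : f r = U r + ω r := by simp [hω]
  have hf2 (r : ℝ) : deriv f r = deriv U r + deriv ω r := by
    have : deriv ω r = deriv f r - deriv U r :=
      deriv_fun_sub (hf.contDiff.differentiable (by norm_num) r)
        (hUe.contDiff.differentiable (by norm_num) r)
    rw [this]; ring
  have hkle : k ^ 2 ≤ 2 * lam := by linarith [(abs_le.1 (hAC ρ)).2]
  -- the pointwise estimate
  have hpt : ∀ r ∈ Ioi (0 : ℝ),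
      |r * energyForm A lam R f r - r * (deriv U r ^ 2 + -lam * U r ^ 2)|
      ≤ (η + 2 * C / lam) * (r * (deriv U r ^ 2 + lam * U r ^ 2))
        + 6 * c / η * (r * (deriv ω r ^ 2 + lam * ω r ^ 2))
        + 21 * c * lam * (r * (farSet ρ 1).indicator (fun s => U s ^ 2) r) := by
    intro r hr
    have hr0 : (0 : ℝ) < r := hr
    rw [← mul_sub, abs_mul, abs_of_pos hr0]
    suffices h : |energyForm A lam R f r - (deriv U r ^ 2 + -lam * U r ^ 2)|
        ≤ (η + 2 * C / lam) * (deriv U r ^ 2 + lam * U r ^ 2)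
        + 6 * c / η * (deriv ω r ^ 2 + lam * ω r ^ 2)
        + 21 * c * lam * (farSet ρ 1).indicator (fun s => U s ^ 2) r by
      calc _ ≤ r * _ := mul_le_mul_of_nonneg_left h hr0.le
        _ = _ := by ring
    by_cases hfar : r ∈ farSet ρ 1
    · rw [indicator_of_mem hfar, energyForm, hf1, hf2]
      have hd := deriv_peak_sq_le a k ρ r
      obtain ⟨g1, g2, g3⟩ := hc (r / R)
      exact abs_energy_sub_le_of_far hlam1 hlamC hC0 (hAC r) hη hη1 hc1 g1 g2 g3 hR
        (hd.trans (mul_le_mul_of_nonneg_right hkle (sq_nonneg _)))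
    · rw [indicator_of_notMem hfar, mul_zero, add_zero]
      obtain ⟨-, e1, e2, e3⟩ := weights_of_abs_lt (div_max_one_lt_two hr0 hfar)
      rw [energyForm, e1, e2, e3, hf1, hf2]
      have h := abs_energy_sub_le_of_near (x := U r) (x' := deriv U r) (h := ω r)
        (h' := deriv ω r) hlam0 hlamC hC0 (hAC r) hη hη1 hc1
      rwa [one_mul, one_mul, zero_div, zero_mul, add_zero, neg_mul, ← sub_eq_add_neg]
  have hint := abs_setIntegral_sub_le (hf.integrableOn_energyForm hA hAC lam R)
    (hUe.integrableOn_energy (-lam))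
    ((((hUe.integrableOn_energy lam).const_mul (η + 2 * C / lam)).add
      ((hωe.integrableOn_energy lam).const_mul (6 * c / η))).add
      ((hUe.integrableOn_far ρ 1).const_mul (21 * c * lam))) hpt
  have hsum : ∫ r in Ioi (0 : ℝ), ((η + 2 * C / lam) * (r * (deriv U r ^ 2 + lam * U r ^ 2))
        + 6 * c / η * (r * (deriv ω r ^ 2 + lam * ω r ^ 2))
        + 21 * c * lam * (r * (farSet ρ 1).indicator (fun s => U s ^ 2) r))
      = (η + 2 * C / lam) * energy lam U + 6 * c / η * energy lam ω
        + 21 * c * lam * farMass U ρ 1 := by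
    have i1 := (hUe.integrableOn_energy lam).const_mul (η + 2 * C / lam)
    have i2 := (hωe.integrableOn_energy lam).const_mul (6 * c / η)
    have i3 := (hUe.integrableOn_far ρ 1).const_mul (21 * c * lam)
    refine (integral_add (i1.add i2) i3).trans ?_
    refine (congrArg (· + _) (integral_add i1 i2)).trans ?_
    rw [integral_const_mul, integral_const_mul, integral_const_mul, ← hUe.energy_eq,
      ← hωe.energy_eq, farMass]
  rw [← hUe.energy_eq (-lam)] at hint
  have hint2 := hint.trans (le_of_eq hsum)
  have e0 : energy (-lam) U = mass (deriv U) - lam * mass U := by rw [energy]; ring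
  rw [e0] at hint2
  refine hint2.trans ?_
  have hm := mass_nonneg U
  have hE : energy lam U ≤ 3 * (lam * mass U) := by
    have h1 := mass_deriv_peak_le a hk hρ
    rw [← hU] at h1
    rw [energy]
    nlinarith [mul_le_mul_of_nonneg_right hkle hm, mul_nonneg hlam0.le hm]
  have hF : farMass U ρ 1 ≤ 64 / k * mass U := by
    have h1 := farMass_peak_le a hk hρ zero_le_one
    rw [← hU] at h1
    refine h1.trans ?_
    have hpi := Real.pi_le_four
    gcongr ?_ / ?_ * _
    · linarith
    · linarith
  have hEω := energy_nonneg hlam0.le ω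
  have s1 : (η + 2 * C / lam) * energy lam U ≤ (η + 2 * C / lam) * (3 * (lam * mass U)) := by
    gcongr
  have s2 : 21 * c * lam * farMass U ρ 1 ≤ 21 * c * lam * (64 / k * mass U) := by gcongr
  have s3 : 6 * c / η * energy lam ω ≤ 1344 * c / η * energy lam ω := by gcongr; norm_num
  have s4 : (η + 2 * C / lam) * (3 * (lam * mass U))
      ≤ 1344 * c * (η + C / lam) * (lam * mass U) := by
    rw [← mul_assoc]
    refine mul_le_mul_of_nonneg_right ?_ (by positivity)
    have : 0 ≤ C / lam := by positivity
    rw [mul_div_assoc]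
    nlinarith
  have s5 : 21 * c * lam * (64 / k * mass U) = 1344 * c * (1 / k) * (lam * mass U) := by ring
  nlinarith

theorem abs_virialForm_sub_le {A f : ℝ → ℝ} {R C : ℝ} (hR : 0 < R) (hC : ∀ r, |deriv A r| ≤ C)
    (r : ℝ) {g : ℝ → ℝ} : |virialForm A R f r - virialForm A R g r|
      ≤ 3 * R * C * |f r ^ 2 - g r ^ 2| := by
  have h := abs_mul_cutoff_le (r / R)
  have e : virialForm A R f r - virialForm A R g r
      = R * (r / R * cutoff (r / R)) * deriv A r * (f r ^ 2 - g r ^ 2) := by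
    simp only [virialForm]; ring
  rw [e, abs_mul, abs_mul, abs_mul, abs_of_pos hR]
  calc R * |r / R * cutoff (r / R)| * |deriv A r| * |f r ^ 2 - g r ^ 2|
      ≤ R * 3 * C * |f r ^ 2 - g r ^ 2| := by gcongr; exact hC r
    _ = _ := by ring

theorem virialForm_bound {A f : ℝ → ℝ} {R C : ℝ} (hR : 0 < R) (hA : Continuous (deriv A))
    (hC : ∀ r, |deriv A r| ≤ C) (hf : FiniteEnergy f) :
    |∫ r in Ioi (0 : ℝ), r * virialForm A R f r| ≤ 3 * R * C * mass f := by
  have h := abs_setIntegral_sub_le (G := fun _ => 0) (hf.integrableOn_virialForm hA hC R)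
    integrableOn_zero (hf.integrableOn.const_mul (3 * R * C)) fun r hr => by
      have hr0 : (0 : ℝ) < r := hr
      have h := abs_virialForm_sub_le (f := f) (g := fun _ => 0) hR hC r
      have e : virialForm A R (fun _ => 0) r = 0 := by simp [virialForm]
      rw [e, sub_zero, zero_pow two_ne_zero, sub_zero, abs_of_nonneg (sq_nonneg (f r))] at h
      rw [sub_zero, abs_mul, abs_of_pos hr0]
      calc _ ≤ r * (3 * R * C * f r ^ 2) := by gcongr
        _ = _ := by ring
  rw [integral_zero, sub_zero, integral_const_mul] at h
  exact h

theorem virialForm_stability {A f U : ℝ → ℝ} {R C η : ℝ} (hR : 0 < R) (hA : Continuous (deriv A))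
    (hC : ∀ r, |deriv A r| ≤ C) (hf : FiniteEnergy f) (hU : FiniteEnergy U)
    (hη : 0 < η) (hη1 : η ≤ 1) :
    |(∫ r in Ioi (0 : ℝ), r * virialForm A R f r) - ∫ r in Ioi (0 : ℝ), r * virialForm A R U r|
      ≤ 3 * R * C * (η * mass U + 2 / η * mass (fun s => f s - U s)) := by
  have hω := hf.sub hU
  have hC0 : 0 ≤ C := (abs_nonneg _).trans (hC 0)
  have i1 := hU.integrableOn.const_mul η
  have i2 := hω.integrableOn.const_mul (2 / η)
  have h := abs_setIntegral_sub_le (hf.integrableOn_virialForm hA hC R)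
    (hU.integrableOn_virialForm hA hC R) ((i1.add i2).const_mul (3 * R * C)) fun r hr => by
      have hr0 : (0 : ℝ) < r := hr
      have h1 := abs_add_sq_sub_sq_le hη hη1 (U r) (f r - U r)
      rw [add_sub_cancel] at h1
      rw [← mul_sub, abs_mul, abs_of_pos hr0]
      calc _ ≤ r * (3 * R * C * (η * U r ^ 2 + 2 / η * (f r - U r) ^ 2)) := by
            refine mul_le_mul_of_nonneg_left ?_ hr0.le
            refine (abs_virialForm_sub_le hR hC r).trans ?_
            gcongr
        _ = _ := by simp only [Pi.add_apply]; ring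
  refine h.trans (le_of_eq ?_)
  rw [integral_const_mul]
  refine congrArg _ ((integral_add i1 i2).trans ?_)
  rw [integral_const_mul, integral_const_mul, mass, mass]

/-- Concentration: the potential side of the Pohozaev identity, for a peak at distance `ρ` from the
origin, only sees the derivative of the potential at `ρ`. -/
theorem virialForm_peak {A : ℝ → ℝ} {C a k ρ η δ : ℝ} (hA : Continuous (deriv A))
    (hC : ∀ r, |deriv A r| ≤ C) (hk : 0 < k) (hρ : 1 ≤ ρ) (hδ : 0 < δ) (hδ1 : δ ≤ 1) (hη : 0 ≤ η)
    (hunif : ∀ r, |r - ρ| < δ → |deriv A r - deriv A ρ| ≤ η) :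
    |(∫ r in Ioi (0 : ℝ), r * virialForm A ρ (peak a k ρ) r)
        - ρ * deriv A ρ * mass (peak a k ρ)|
      ≤ ρ * (η + C / ρ + 256 * C / (k * δ)) * mass (peak a k ρ) := by
  set U := peak a k ρ with hUdef
  have hρ0 : 0 < ρ := by linarith
  have hU : FiniteEnergy U := finiteEnergy_peak a hk hρ0.le
  have hC0 : 0 ≤ C := (abs_nonneg _).trans (hC 0)
  have i1 := hU.integrableOn.const_mul (ρ * (η + C / ρ))
  have i2 := (hU.integrableOn_far ρ δ).const_mul (ρ * (4 * C))
  have h := abs_setIntegral_sub_le (hU.integrableOn_virialForm hA hC ρ)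
    (hU.integrableOn.const_mul (ρ * deriv A ρ)) (i1.add i2) fun r hr => by
      have hr0 : (0 : ℝ) < r := hr
      have e : r * virialForm A ρ U r - ρ * deriv A ρ * (r * U r ^ 2)
          = ρ * (r * U r ^ 2) * (r / ρ * cutoff (r / ρ) * deriv A r - deriv A ρ) := by
        simp only [virialForm]; ring
      rw [e, abs_mul, abs_of_nonneg (by positivity)]
      simp only [Pi.add_apply]
      by_cases hfar : r ∈ farSet ρ δ
      · rw [indicator_of_mem hfar]
        have h1 : |r / ρ * cutoff (r / ρ) * deriv A r - deriv A ρ| ≤ 4 * C := by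
          refine (abs_sub _ _).trans ?_
          rw [abs_mul]
          have h2 : |r / ρ * cutoff (r / ρ)| * |deriv A r| ≤ 3 * C := by
            gcongr
            · exact abs_mul_cutoff_le _
            · exact hC r
          linarith [hC ρ]
        have h3 : 0 ≤ ρ * (η + C / ρ) * (r * U r ^ 2) := by positivity
        calc _ ≤ ρ * (r * U r ^ 2) * (4 * C) := by gcongr
          _ ≤ _ := by linarith
      · rw [indicator_of_notMem hfar, mul_zero, mul_zero, add_zero]
        have h1 : |r - ρ| < δ := by simpa [farSet] using hfar
        have h2 : |r / ρ| < 2 := by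
          rw [abs_div, abs_of_pos hr0, abs_of_pos hρ0, div_lt_iff₀ hρ0]
          linarith [(abs_lt.1 h1).2]
        rw [(weights_of_abs_lt h2).1, mul_one]
        have h3 : |r / ρ * deriv A r - deriv A ρ| ≤ η + C / ρ := by
          have e2 : r / ρ * deriv A r - deriv A ρ
              = (deriv A r - deriv A ρ) + (r - ρ) / ρ * deriv A r := by
            field_simp; ring
          rw [e2]
          refine (abs_add_le _ _).trans (add_le_add (hunif r h1) ?_)
          rw [abs_mul, abs_div, abs_of_pos hρ0]
          calc |r - ρ| / ρ * |deriv A r| ≤ 1 / ρ * C := by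
                gcongr
                · linarith
                · exact hC r
            _ = C / ρ := by ring
        calc _ ≤ ρ * (r * U r ^ 2) * (η + C / ρ) := by gcongr
          _ = _ := by ring
  rw [integral_const_mul] at h
  refine h.trans ?_
  have hF : farMass U ρ δ ≤ 64 / (k * δ) * mass U := by
    refine (farMass_peak_le a hk hρ0.le hδ.le).trans ?_
    have hpi := Real.pi_le_four
    have hm := mass_nonneg (peak a k ρ)
    have hkδ := mul_pos hk hδ
    gcongr ?_ / ?_ * _
    · linarith
    · linarith
  have e1 : ∫ r in Ioi (0 : ℝ), ((fun r => ρ * (η + C / ρ) * (r * U r ^ 2))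
      + fun r => ρ * (4 * C) * (r * (farSet ρ δ).indicator (fun s => U s ^ 2) r)) r
      = ρ * (η + C / ρ) * mass U + ρ * (4 * C) * farMass U ρ δ := by
    refine (integral_add i1 i2).trans ?_
    rw [integral_const_mul, integral_const_mul, mass, farMass]
  rw [e1]
  have h4 : ρ * (4 * C) * farMass U ρ δ ≤ ρ * (4 * C) * (64 / (k * δ) * mass U) := by gcongr
  have e2 : ρ * (4 * C) * (64 / (k * δ) * mass U) = ρ * (256 * C / (k * δ)) * mass U := by ring
  rw [e2] at h4
  have e3 : ρ * (η + C / ρ + 256 * C / (k * δ)) * mass U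
      = ρ * (η + C / ρ) * mass U + ρ * (256 * C / (k * δ)) * mass U := by ring
  rw [e3]
  exact add_le_add_right h4 _

/-! ### The Pohozaev identity on a pair of peaks -/

theorem energy_peak_le (a : ℝ) {k ρ lam : ℝ} (hk : 0 < k) (hρ : 0 ≤ ρ) (hlam : 0 ≤ lam)
    (hkle : k ^ 2 ≤ 2 * lam) : energy lam (peak a k ρ) ≤ 3 * (lam * mass (peak a k ρ)) := by
  have h1 := mass_deriv_peak_le a hk hρ
  have hm := mass_nonneg (peak a k ρ)
  have h2 := mul_le_mul_of_nonneg_right hkle hm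
  have h3 := mul_nonneg hlam hm
  rw [energy]
  linarith

theorem half_sqrt_le_sqrt_add {lam C x : ℝ} (hlam : 0 ≤ lam) (hlamC : 2 * C ≤ lam) (hx : |x| ≤ C) :
    √lam / 2 ≤ √(lam + x) := by
  refine Real.le_sqrt_of_sq_le ?_
  rw [div_pow, Real.sq_sqrt hlam]
  linarith [(abs_le.1 hx).1]

/-- The error of the ansatz, measured in energy, is small compared to `lam` times the total mass of
the two peaks. -/
theorem energy_error_le {P Q : Plane → ℝ} {p q : ℝ → ℝ} {a b ρ lam C η : ℝ}
    (hP : Continuous (profile P)) (hQ : Continuous (profile Q))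
    (hPC : ∀ r, |profile P r| ≤ C) (hQC : ∀ r, |profile Q r| ≤ C)
    (hp : FiniteEnergy p) (hq : FiniteEnergy q) (hρ : 0 ≤ ρ) (hlam : 1 ≤ lam) (hlamC : 2 * C ≤ lam)
    {U V : ℝ → ℝ} (hU : U = peak a (√(lam + profile P ρ)) ρ)
    (hV : V = peak b (√(lam + profile Q ρ)) ρ) (hη : 0 < η)
    (herr : pairNorm P Q lam (fun s => p s - U s) (fun s => q s - V s) ≤ η * pairNorm P Q lam U V) :
    energy lam (fun s => p s - U s) + energy lam (fun s => q s - V s)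
      ≤ 12 * η ^ 2 * (lam * (mass U + mass V)) := by
  have hlam0 : 0 < lam := by linarith
  have hk {x : ℝ} (hx : |x| ≤ C) : 0 < √(lam + x) ∧ √(lam + x) ^ 2 ≤ 2 * lam := by
    have := abs_le.1 hx
    refine ⟨lt_of_lt_of_le (by positivity) (half_sqrt_le_sqrt_add hlam0.le hlamC hx), ?_⟩
    rw [Real.sq_sqrt (by linarith)]
    linarith
  obtain ⟨k1, k1'⟩ := hk (hPC ρ)
  obtain ⟨k2, k2'⟩ := hk (hQC ρ)
  have hUe : FiniteEnergy U := hU ▸ finiteEnergy_peak a k1 hρ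
  have hVe : FiniteEnergy V := hV ▸ finiteEnergy_peak b k2 hρ
  have n1 := (hp.sub hUe).normSq_bounds hP hPC hlamC
  have n2 := (hq.sub hVe).normSq_bounds hQ hQC hlamC
  have n3 := hUe.normSq_bounds hP hPC hlamC
  have n4 := hVe.normSq_bounds hQ hQC hlamC
  have e1 := energy_nonneg hlam0.le (fun s => p s - U s)
  have e2 := energy_nonneg hlam0.le (fun s => q s - V s)
  have e3 := energy_nonneg hlam0.le U
  have e4 := energy_nonneg hlam0.le V
  have m1 : energy lam U ≤ 3 * (lam * mass U) := hU ▸ energy_peak_le a k1 hρ hlam0.le k1'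
  have m2 : energy lam V ≤ 3 * (lam * mass V) := hV ▸ energy_peak_le b k2 hρ hlam0.le k2'
  have h := pow_le_pow_left₀ (Real.sqrt_nonneg _) herr 2
  unfold pairNorm at h
  rw [mul_pow, Real.sq_sqrt (by linarith), Real.sq_sqrt (by linarith)] at h
  have h2 : η ^ 2 * (normSq P lam U + normSq Q lam V)
      ≤ η ^ 2 * (6 * (lam * (mass U + mass V))) := by
    gcongr
    linarith
  linarith

/-- The Pohozaev identity of a solution that is close to a pair of peaks, evaluated on the peaks. -/
theorem pohozaev_peaks (C : ℝ) : ∃ K : ℝ, 0 ≤ K ∧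
    ∀ {P Q : Plane → ℝ} {p q : ℝ → ℝ} {α β γ a b ρ lam η : ℝ}
    {U V : ℝ → ℝ}, ContDiff ℝ 1 (profile P) → ContDiff ℝ 1 (profile Q) →
    (∀ r, |profile P r| ≤ C) → (∀ r, |profile Q r| ≤ C) →
    (∀ r, |deriv (profile P) r| ≤ C) → (∀ r, |deriv (profile Q) r| ≤ C) →
    ContDiff ℝ 2 p → ContDiff ℝ 2 q → FiniteEnergy p → FiniteEnergy q →
    (∀ r, 0 < r → deriv (deriv p) r + deriv p r / r
      = (lam + profile P r) * p r - α * p r ^ 3 - β * p r * q r ^ 2) →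
    (∀ r, 0 < r → deriv (deriv q) r + deriv q r / r
      = (lam + profile Q r) * q r - γ * q r ^ 3 - β * p r ^ 2 * q r) →
    0 ≤ ρ → 1 ≤ lam → 2 * C ≤ lam →
    U = peak a (√(lam + profile P ρ)) ρ → V = peak b (√(lam + profile Q ρ)) ρ → 0 < η → η ≤ 1 →
    pairNorm P Q lam (fun s => p s - U s) (fun s => q s - V s) ≤ η * pairNorm P Q lam U V →
    |((∫ r in Ioi (0 : ℝ), r * virialForm (profile P) (max 1 ρ) U r)
        + ∫ r in Ioi (0 : ℝ), r * virialForm (profile Q) (max 1 ρ) V r)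
      - ((mass (deriv U) - lam * mass U) + (mass (deriv V) - lam * mass V))|
    ≤ K * (η + 1 / √lam) * (lam + max 1 ρ) * (mass U + mass V) := by
  obtain ⟨K, hK, hstab⟩ := energyForm_stability
  refine ⟨13 * K * (|C| + 2) + 75 * |C|, by positivity, ?_⟩
  intro P Q p q α β γ a b ρ lam η U V hP hQ hPC hQC hPC' hQC' hp2 hq2 hp hq eqp eqq hρ hlam hlamC
    hU hV hη hη1 herr
  have hC0 : 0 ≤ C := (abs_nonneg _).trans (hPC 0)
  rw [abs_of_nonneg hC0]
  have hlam0 : 0 < lam := by linarith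
  have hs1 : 1 ≤ √lam := Real.one_le_sqrt.2 hlam
  have hs0 : 0 < √lam := by linarith
  have herr2 := energy_error_le hP.continuous hQ.continuous hPC hQC hp hq hρ hlam hlamC hU hV
    hη herr
  have hR1 : 1 ≤ max 1 ρ := le_max_left _ _
  set R := max 1 ρ
  have hR : 0 < R := by linarith
  have hk {x : ℝ} (hx : |x| ≤ C) : 0 < √(lam + x) ∧ √(lam + x) ^ 2 = lam + x ∧
      C / lam + 1 / √(lam + x) ≤ (C + 2) * (1 / √lam) := by
    have := abs_le.1 hx
    have hh := half_sqrt_le_sqrt_add hlam0.le hlamC hx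
    refine ⟨lt_of_lt_of_le (by positivity) hh, Real.sq_sqrt (by linarith), ?_⟩
    have h1 : C / lam ≤ C / √lam := by
      gcongr
      rw [Real.sqrt_le_left (by linarith)]
      nlinarith
    have h2 : 1 / √(lam + x) ≤ 1 / (√lam / 2) := by gcongr
    have h3 : 1 / (√lam / 2) = 2 / √lam := by field_simp
    have h4 : (C + 2) * (1 / √lam) = C / √lam + 2 / √lam := by ring
    linarith
  obtain ⟨k1, k1', k1''⟩ := hk (hPC ρ)
  obtain ⟨k2, k2', k2''⟩ := hk (hQC ρ)
  have hUe : FiniteEnergy U := hU ▸ finiteEnergy_peak a k1 hρ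
  have hVe : FiniteEnergy V := hV ▸ finiteEnergy_peak b k2 hρ
  have s1 := hstab (a := a) hP.continuous hPC hp k1 hρ hlam hlamC k1' hη hη1
  have s2 := hstab (a := b) hQ.continuous hQC hq k2 hρ hlam hlamC k2' hη hη1
  rw [← hU] at s1
  rw [← hV] at s2
  have v1 := virialForm_stability hR (hP.continuous_deriv le_rfl) hPC' hp hUe hη hη1
  have v2 := virialForm_stability hR (hQ.continuous_deriv le_rfl) hQC' hq hVe hη hη1
  have key := energyForm_eq_virialForm hR hp2 hq2 hP hQ hp hq hPC hQC hPC' hQC' eqp eqq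
  have hmU := mass_nonneg U
  have hmV := mass_nonneg V
  set μ := mass U + mass V with hμ
  have hμ0 : 0 ≤ μ := add_nonneg hmU hmV
  set eU := energy lam (fun s => p s - U s) with heU
  set eV := energy lam (fun s => q s - V s) with heV
  have d1 : K / η * (eU + eV) ≤ 12 * K * η * (lam * μ) := by
    calc K / η * (eU + eV) ≤ K / η * (12 * η ^ 2 * (lam * μ)) := by gcongr
      _ = _ := by field_simp
  have d2 : mass (fun s => p s - U s) + mass (fun s => q s - V s) ≤ 12 * η ^ 2 * μ := by
    have h1 := mass_nonneg (deriv (fun s => p s - U s))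
    have h2 := mass_nonneg (deriv (fun s => q s - V s))
    have h3 : lam * (mass (fun s => p s - U s) + mass (fun s => q s - V s))
        ≤ lam * (12 * η ^ 2 * μ) := by
      rw [heU, heV, energy, energy] at herr2
      linarith
    exact le_of_mul_le_mul_left h3 hlam0
  have d3 : 3 * R * C * (2 / η * (mass (fun s => p s - U s) + mass (fun s => q s - V s)))
      ≤ 72 * C * η * (R * μ) := by
    calc _ ≤ 3 * R * C * (2 / η * (12 * η ^ 2 * μ)) := by gcongr
      _ = _ := by field_simp; ring
  have d4 : K * (η + C / lam + 1 / √(lam + profile P ρ)) * (lam * mass U)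
      ≤ K * (η + (C + 2) * (1 / √lam)) * (lam * mass U) := by
    gcongr K * ?_ * _
    linarith
  have d5 : K * (η + C / lam + 1 / √(lam + profile Q ρ)) * (lam * mass V)
      ≤ K * (η + (C + 2) * (1 / √lam)) * (lam * mass V) := by
    gcongr K * ?_ * _
    linarith
  have hi0 : 0 ≤ 1 / √lam := by positivity
  have d6 : K * (η + (C + 2) * (1 / √lam)) * (lam * μ) + 12 * K * η * (lam * μ)
      ≤ 13 * K * (C + 2) * (η + 1 / √lam) * (lam * μ) := by
    rw [← add_mul]
    refine mul_le_mul_of_nonneg_right ?_ (by positivity)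
    have h1 := mul_nonneg hK hη.le
    have h2 := mul_nonneg h1 hC0
    have h3 := mul_nonneg hK hi0
    have h4 := mul_nonneg h3 hC0
    linarith
  have d7 : 13 * K * (C + 2) * (η + 1 / √lam) * (lam * μ)
      ≤ 13 * K * (C + 2) * (η + 1 / √lam) * ((lam + R) * μ) := by
    gcongr
    linarith
  have d8 : 75 * C * η * (R * μ) ≤ 75 * C * (η + 1 / √lam) * ((lam + R) * μ) := by
    gcongr <;> linarith
  have s1' := abs_le.1 s1
  have s2' := abs_le.1 s2
  have v1' := abs_le.1 v1
  have v2' := abs_le.1 v2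
  have e1 : K * (η + (C + 2) * (1 / √lam)) * (lam * μ)
      = K * (η + (C + 2) * (1 / √lam)) * (lam * mass U)
        + K * (η + (C + 2) * (1 / √lam)) * (lam * mass V) := by rw [hμ]; ring
  have e2 : 75 * C * η * (R * μ) = 72 * C * η * (R * μ)
      + (3 * R * C * (η * mass U) + 3 * R * C * (η * mass V)) := by rw [hμ]; ring
  rw [mul_add] at d1 d3 v1 v2
  rw [mul_add] at d3
  have e3 : (13 * K * (C + 2) + 75 * C) * (η + 1 / √lam) * (lam + R) * μ
      = 13 * K * (C + 2) * (η + 1 / √lam) * ((lam + R) * μ)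
        + 75 * C * (η + 1 / √lam) * ((lam + R) * μ) := by ring
  rw [e3, abs_le]
  constructor <;> linarith

/-- Comparison of potential and kinetic effects forces the peaks away from the origin. -/
theorem lam_le_of_pohozaev {P Q : Plane → ℝ} {a b ρ lam C θ : ℝ} {U V : ℝ → ℝ}
    (hP : ContDiff ℝ 1 (profile P)) (hQ : ContDiff ℝ 1 (profile Q))
    (hPC : ∀ r, |profile P r| ≤ C) (hQC : ∀ r, |profile Q r| ≤ C)
    (hPC' : ∀ r, |deriv (profile P) r| ≤ C) (hQC' : ∀ r, |deriv (profile Q) r| ≤ C)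
    (ha : 0 < a) (hρ : 0 ≤ ρ) (hlam : 1 ≤ lam) (hlamC : 8 * C ≤ lam)
    (hU : U = peak a (√(lam + profile P ρ)) ρ) (hV : V = peak b (√(lam + profile Q ρ)) ρ)
    (hθ : θ ≤ 1 / 8)
    (h : |((∫ r in Ioi (0 : ℝ), r * virialForm (profile P) (max 1 ρ) U r)
        + ∫ r in Ioi (0 : ℝ), r * virialForm (profile Q) (max 1 ρ) V r)
      - ((mass (deriv U) - lam * mass U) + (mass (deriv V) - lam * mass V))|
      ≤ θ * (lam + max 1 ρ) * (mass U + mass V)) :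
    lam ≤ (24 * C + 1) * max 1 ρ := by
  have hC0 : 0 ≤ C := (abs_nonneg _).trans (hPC 0)
  have hlam0 : 0 < lam := by linarith
  have hk {x : ℝ} (hx : |x| ≤ C) : 0 < √(lam + x) ∧ √(lam + x) ^ 2 = lam + x := by
    have := abs_le.1 hx
    exact ⟨lt_of_lt_of_le (by positivity) (half_sqrt_le_sqrt_add hlam0.le (by linarith) hx),
      Real.sq_sqrt (by linarith)⟩
  obtain ⟨k1, k1'⟩ := hk (hPC ρ)
  obtain ⟨k2, k2'⟩ := hk (hQC ρ)
  have hUe : FiniteEnergy U := hU ▸ finiteEnergy_peak a k1 hρ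
  have hVe : FiniteEnergy V := hV ▸ finiteEnergy_peak b k2 hρ
  have hmU : 0 < mass U := hU ▸ mass_peak_pos ha k1 hρ
  have hmV := mass_nonneg V
  have hR1 : 1 ≤ max 1 ρ := le_max_left _ _
  set R := max 1 ρ
  have hR : 0 < R := by linarith
  have w1 := abs_le.1 (virialForm_bound hR (hP.continuous_deriv le_rfl) hPC' hUe)
  have w2 := abs_le.1 (virialForm_bound hR (hQ.continuous_deriv le_rfl) hQC' hVe)
  have g1 : mass (deriv U) ≤ 2 / 3 * (lam + C) * mass U := by
    have := mass_deriv_peak_le a k1 hρ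
    rw [k1', ← hU] at this
    refine this.trans ?_
    gcongr
    exact (le_abs_self _).trans (hPC ρ)
  have g2 : mass (deriv V) ≤ 2 / 3 * (lam + C) * mass V := by
    have := mass_deriv_peak_le b k2 hρ
    rw [k2', ← hV] at this
    refine this.trans ?_
    gcongr
    exact (le_abs_self _).trans (hQC ρ)
  have hμ : 0 < mass U + mass V := by linarith
  have h' := (abs_le.1 h).2
  have hθ' : θ * (lam + R) * (mass U + mass V) ≤ 1 / 8 * (lam + R) * (mass U + mass V) := by
    gcongr
  have hfin : (lam / 8) * (mass U + mass V) ≤ ((3 * C + 1 / 8) * R) * (mass U + mass V) := by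
    have h1 := mul_le_mul_of_nonneg_right hlamC hμ.le
    linarith
  have := le_of_mul_le_mul_right hfin hμ
  linarith

/-- Both sides of the Pohozaev identity for one peak, up to errors of relative size `τ`. -/
theorem peak_terms_approx {R : Plane → ℝ} {c k ρ lam C η δ τ : ℝ} {W : ℝ → ℝ}
    (hW : W = peak c k ρ) (hR : ContDiff ℝ 1 (profile R)) (hRC : ∀ r, |profile R r| ≤ C)
    (hRC' : ∀ r, |deriv (profile R) r| ≤ C) (hlam : 1 ≤ lam) (hlamC : 2 * C ≤ lam) (hρ1 : 1 ≤ ρ)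
    (hk : √lam / 2 ≤ k) (hksq : k ^ 2 = lam + profile R ρ) (hη : 0 ≤ η) (hδ : 0 < δ) (hδ1 : δ ≤ 1)
    (hu : ∀ r, |r - ρ| < δ → |deriv (profile R) r - deriv (profile R) ρ| ≤ η)
    (hτ : η + 1 / ρ + 1 / (√lam * δ) ≤ τ) :
    |(∫ r in Ioi (0 : ℝ), r * virialForm (profile R) ρ W r) - ρ * deriv (profile R) ρ * mass W|
      ≤ ρ * ((1 + C + 512 * C) * τ) * mass W ∧
    |mass (deriv W) - lam * mass W + 2 / 3 * lam * mass W|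
      ≤ (lam + ρ) * (2 + C) * τ * mass W := by
  have hC0 : 0 ≤ C := (abs_nonneg _).trans (hRC 0)
  have hρ0 : 0 < ρ := by linarith
  have hlam0 : 0 < lam := by linarith
  have hs1 : 1 ≤ √lam := Real.one_le_sqrt.2 hlam
  have hs0 : 0 < √lam := by linarith
  have hρi : 0 ≤ 1 / ρ := by positivity
  have hδi : 0 ≤ 1 / (√lam * δ) := by positivity
  have hτ0 : 0 ≤ τ := by linarith
  have hk0 : 0 < k := lt_of_lt_of_le (by positivity) hk
  have hm : 0 ≤ mass W := mass_nonneg W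
  have hx := abs_le.1 (hRC ρ)
  constructor
  · have h1 := virialForm_peak (a := c) (hR.continuous_deriv le_rfl) hRC' hk0 hρ1 hδ hδ1 hη hu
    rw [← hW] at h1
    refine h1.trans ?_
    gcongr ρ * ?_ * _
    have h2 : 256 * C / (k * δ) ≤ 512 * C * (1 / (√lam * δ)) := by
      calc 256 * C / (k * δ) ≤ 256 * C / (√lam / 2 * δ) := by gcongr
        _ = _ := by field_simp; ring
    have h3 : C / ρ = C * (1 / ρ) := by ring
    have h4 : 512 * C * (1 / (√lam * δ)) ≤ 512 * C * τ := by
      gcongr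
      linarith
    have h5 : C * (1 / ρ) ≤ C * τ := by
      gcongr
      linarith
    linarith
  · have h1 := abs_mass_deriv_peak_sub_le c hk0 hρ0.le
    rw [← hW] at h1
    have h2 : |mass (deriv W) - k ^ 2 / 3 * mass W| ≤ 2 * lam * (1 / ρ) * mass W := by
      have h3 : ρ ≤ 1 + 2 * (k * ρ) := by nlinarith
      have h4 : |mass (deriv W) - k ^ 2 / 3 * mass W| * ρ ≤ 2 * lam * mass W := by
        refine (mul_le_mul_of_nonneg_left h3 (abs_nonneg _)).trans (h1.trans ?_)
        gcongr
        linarith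
      rw [← le_div_iff₀ hρ0] at h4
      refine h4.trans (le_of_eq ?_)
      ring
    have e : mass (deriv W) - lam * mass W + 2 / 3 * lam * mass W
        = (mass (deriv W) - k ^ 2 / 3 * mass W) + profile R ρ / 3 * mass W := by
      rw [hksq]; ring
    rw [e]
    refine (abs_add_le _ _).trans ?_
    have h5 : |profile R ρ / 3 * mass W| ≤ C * mass W := by
      rw [abs_mul, abs_of_nonneg hm]
      gcongr
      rw [abs_div, abs_of_pos (by norm_num : (0 : ℝ) < 3)]
      linarith [hRC ρ, abs_nonneg (profile R ρ)]
    have h6 : 2 * lam * (1 / ρ) * mass W ≤ 2 * (lam + ρ) * τ * mass W := by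
      gcongr
      · linarith
      · linarith
    have h7 : C * mass W ≤ (lam + ρ) * C * τ * mass W := by
      gcongr
      have : 1 ≤ (lam + ρ) * τ := by
        calc (1 : ℝ) = ρ * (1 / ρ) := by field_simp
          _ ≤ (lam + ρ) * τ := by gcongr <;> linarith
      nlinarith
    linarith

/-- The masses of the two peaks are nearly in the ratio `a² : b²`. -/
theorem mass_ratio_approx {a b k₁ k₂ ρ lam C L x y A' B' : ℝ} {U V : ℝ → ℝ}
    (hL : 0 ≤ L) (hLip : ∀ A B : ℝ, 0 ≤ A → 0 ≤ B →
      |moment A (fun y => w y ^ 2) - moment B (fun y => w y ^ 2)| ≤ L * |A - B|)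
    (hU : U = peak a k₁ ρ) (hV : V = peak b k₂ ρ) (ha : 0 < a) (hb : 0 < b) (hρ0 : 0 < ρ)
    (hlam : 1 ≤ lam) (k1' : √lam / 2 ≤ k₁) (k2' : √lam / 2 ≤ k₂)
    (k1sq : k₁ ^ 2 = lam + x) (k2sq : k₂ ^ 2 = lam + y) (hC0 : 0 ≤ C)
    (hx : |x| ≤ C) (hy : |y| ≤ C) (hA : |A'| ≤ C) (hB : |B'| ≤ C) :
    |(A' * mass U + B' * mass V) * (a ^ 2 + b ^ 2)
        - (a ^ 2 * A' + b ^ 2 * B') * (mass U + mass V)|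
      ≤ (4 * C ^ 2 * L * (1 / √lam)) * ((a ^ 2 + b ^ 2) * (mass U + mass V)) := by
  have hs1 : 1 ≤ √lam := Real.one_le_sqrt.2 hlam
  have hs0 : 0 < √lam := by linarith
  have k1 : 0 < k₁ := lt_of_lt_of_le (by positivity) k1'
  have k2 : 0 < k₂ := lt_of_lt_of_le (by positivity) k2'
  set I₁ := moment (k₁ * ρ) (fun y => w y ^ 2) with hI₁
  set I₂ := moment (k₂ * ρ) (fun y => w y ^ 2) with hI₂
  have eU : mass U = a ^ 2 * I₁ := by rw [hU, mass_peak a k1]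
  have eV : mass V = b ^ 2 * I₂ := by rw [hV, mass_peak b k2]
  have g1 : ρ ≤ I₁ := by
    have := two_mul_add_one_le_moment_w (mul_nonneg k1.le hρ0.le)
    nlinarith
  have g2 : ρ ≤ I₂ := by
    have := two_mul_add_one_le_moment_w (mul_nonneg k2.le hρ0.le)
    nlinarith
  have g3 : |I₁ - I₂| ≤ L * (2 * C * (1 / √lam) * ρ) := by
    refine (hLip _ _ (by positivity) (by positivity)).trans ?_
    rw [← sub_mul, abs_mul, abs_of_pos hρ0]
    gcongr
    have e : (k₁ - k₂) * (k₁ + k₂) = x - y := by linear_combination k1sq - k2sq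
    have h1 : |k₁ - k₂| * √lam ≤ 2 * C := by
      calc |k₁ - k₂| * √lam ≤ |k₁ - k₂| * (k₁ + k₂) := by gcongr; linarith
        _ = |x - y| := by rw [← e, abs_mul, abs_of_pos (add_pos k1 k2)]
        _ ≤ _ := (abs_sub _ _).trans (by linarith [hx, hy])
    rw [← le_div_iff₀ hs0] at h1
    rwa [mul_one_div]
  have g4 : |A' - B'| ≤ 2 * C := (abs_sub _ _).trans (by linarith [hA, hB])
  have e : (A' * mass U + B' * mass V) * (a ^ 2 + b ^ 2)
        - (a ^ 2 * A' + b ^ 2 * B') * (mass U + mass V)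
      = a ^ 2 * b ^ 2 * (I₁ - I₂) * (A' - B') := by
    rw [eU, eV]; ring
  rw [e, abs_mul, abs_mul, abs_of_nonneg (by positivity : 0 ≤ a ^ 2 * b ^ 2)]
  have g5 : (a ^ 2 + b ^ 2) * ρ ≤ mass U + mass V := by
    rw [eU, eV, add_mul]
    gcongr
  have g6 : a ^ 2 * b ^ 2 ≤ (a ^ 2 + b ^ 2) * (a ^ 2 + b ^ 2) := by
    nlinarith [pow_pos ha 2, pow_pos hb 2]
  calc a ^ 2 * b ^ 2 * |I₁ - I₂| * |A' - B'|
      ≤ (a ^ 2 + b ^ 2) * (a ^ 2 + b ^ 2) * (L * (2 * C * (1 / √lam) * ρ)) * (2 * C) := by gcongr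
    _ = (4 * C ^ 2 * L * (1 / √lam)) * ((a ^ 2 + b ^ 2) * ((a ^ 2 + b ^ 2) * ρ)) := by ring
    _ ≤ _ := by gcongr

/-- The balance between the averaged potential force at the peaks and the curvature of the ring
on which they concentrate. -/
theorem balance_of_pohozaev (C : ℝ) : ∃ K : ℝ, 0 ≤ K ∧
    ∀ {P Q : Plane → ℝ} {a b ρ lam θ η δ : ℝ} {U V : ℝ → ℝ},
    ContDiff ℝ 1 (profile P) → ContDiff ℝ 1 (profile Q) →
    (∀ r, |profile P r| ≤ C) → (∀ r, |profile Q r| ≤ C) →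
    (∀ r, |deriv (profile P) r| ≤ C) → (∀ r, |deriv (profile Q) r| ≤ C) →
    0 < a → 0 < b → 1 ≤ ρ → 1 ≤ lam → 2 * C ≤ lam →
    U = peak a (√(lam + profile P ρ)) ρ → V = peak b (√(lam + profile Q ρ)) ρ →
    0 ≤ θ → 0 ≤ η → 0 < δ → δ ≤ 1 →
    (∀ r, |r - ρ| < δ → |deriv (profile P) r - deriv (profile P) ρ| ≤ η) →
    (∀ r, |r - ρ| < δ → |deriv (profile Q) r - deriv (profile Q) ρ| ≤ η) →
    |((∫ r in Ioi (0 : ℝ), r * virialForm (profile P) (max 1 ρ) U r)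
        + ∫ r in Ioi (0 : ℝ), r * virialForm (profile Q) (max 1 ρ) V r)
      - ((mass (deriv U) - lam * mass U) + (mass (deriv V) - lam * mass V))|
      ≤ θ * (lam + max 1 ρ) * (mass U + mass V) →
    |(a ^ 2 * deriv (profile P) ρ + b ^ 2 * deriv (profile Q) ρ) / (a ^ 2 + b ^ 2)
        + 2 / 3 * (lam / ρ)|
      ≤ K * (θ + η + 1 / ρ + 1 / (√lam * δ)) * (1 + lam / ρ) := by
  obtain ⟨L, hL, hLip⟩ := moment_w_lipschitz
  refine ⟨4 + 2 * |C| + 512 * |C| + 4 * |C| ^ 2 * L, by positivity, ?_⟩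
  intro P Q a b ρ lam θ η δ U V hP hQ hPC hQC hPC' hQC' ha hb hρ1 hlam hlamC hU hV hθ hη hδ hδ1
    hPu hQu h
  have hC0 : 0 ≤ C := (abs_nonneg _).trans (hPC 0)
  rw [abs_of_nonneg hC0]
  have hρ0 : 0 < ρ := by linarith
  have hlam0 : 0 < lam := by linarith
  have hs1 : 1 ≤ √lam := Real.one_le_sqrt.2 hlam
  have hs0 : 0 < √lam := by linarith
  rw [max_eq_right hρ1] at h
  have hk {x : ℝ} (hx : |x| ≤ C) : √lam / 2 ≤ √(lam + x) ∧ √(lam + x) ^ 2 = lam + x := by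
    have := abs_le.1 hx
    exact ⟨half_sqrt_le_sqrt_add hlam0.le hlamC hx, Real.sq_sqrt (by linarith)⟩
  set k₁ := √(lam + profile P ρ) with hk₁
  set k₂ := √(lam + profile Q ρ) with hk₂
  obtain ⟨k1', k1sq⟩ := hk (hPC ρ)
  obtain ⟨k2', k2sq⟩ := hk (hQC ρ)
  rw [← hk₁] at k1' k1sq
  rw [← hk₂] at k2' k2sq
  have k1 : 0 < k₁ := lt_of_lt_of_le (by positivity) k1'
  have k2 : 0 < k₂ := lt_of_lt_of_le (by positivity) k2'
  have hmU : 0 < mass U := hU ▸ mass_peak_pos ha k1 hρ0.le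
  have hmV : 0 < mass V := hV ▸ mass_peak_pos hb k2 hρ0.le
  set A' := deriv (profile P) ρ with hA'
  set B' := deriv (profile Q) ρ with hB'
  set τ := θ + η + 1 / ρ + 1 / (√lam * δ) with hτ
  have hρi : 0 ≤ 1 / ρ := by positivity
  have hδi : 0 ≤ 1 / (√lam * δ) := by positivity
  have hτ0 : 0 ≤ τ := by positivity
  have hτ' : η + 1 / ρ + 1 / (√lam * δ) ≤ τ := by linarith
  obtain ⟨f1, f2⟩ := peak_terms_approx hU hP hPC hPC' hlam hlamC hρ1 k1' k1sq hη hδ hδ1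
    hPu hτ'
  obtain ⟨f3, f4⟩ := peak_terms_approx hV hQ hQC hQC' hlam hlamC hρ1 k2' k2sq hη hδ hδ1
    hQu hτ'
  rw [← hA'] at f1
  rw [← hB'] at f3
  set μ := mass U + mass V with hμ
  have hμ0 : 0 < μ := by linarith
  -- the balance with the masses of the peaks as weights
  have main : |ρ * (A' * mass U + B' * mass V) + 2 / 3 * lam * μ|
      ≤ (2 + 2 * C + 512 * C + 2) * τ * (lam + ρ) * μ := by
    have t1 : θ * (lam + ρ) ≤ τ * (lam + ρ) := by
      gcongr
      linarith
    have t2 : ρ * ((1 + C + 512 * C) * τ) ≤ (lam + ρ) * ((1 + C + 512 * C) * τ) := by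
      gcongr
      linarith
    have t3 : θ * (lam + ρ) + ρ * ((1 + C + 512 * C) * τ) + (lam + ρ) * (2 + C) * τ
        ≤ (2 + 2 * C + 512 * C + 2) * τ * (lam + ρ) := by linarith
    refine le_trans ?_ (mul_le_mul_of_nonneg_right t3 hμ0.le)
    clear t1 t2 t3
    generalize θ * (lam + ρ) = c₁ at *
    generalize ρ * ((1 + C + 512 * C) * τ) = c₂ at *
    generalize (lam + ρ) * (2 + C) * τ = c₃ at *
    generalize (∫ r in Ioi (0 : ℝ), r * virialForm (profile P) ρ U r) = X at *
    generalize (∫ r in Ioi (0 : ℝ), r * virialForm (profile Q) ρ V r) = Y at *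
    have e : ρ * (A' * mass U + B' * mass V) + 2 / 3 * lam * μ
        = (X + Y - (mass (deriv U) - lam * mass U + (mass (deriv V) - lam * mass V)))
          - ((X - ρ * A' * mass U) + (Y - ρ * B' * mass V))
          + ((mass (deriv U) - lam * mass U + 2 / 3 * lam * mass U)
            + (mass (deriv V) - lam * mass V + 2 / 3 * lam * mass V)) := by
      rw [hμ]; ring
    have e2 : (c₁ + c₂ + c₃) * μ
        = c₁ * μ + (c₂ * mass U + c₂ * mass V) + (c₃ * mass U + c₃ * mass V) := by
      rw [hμ]; ring
    rw [e, e2]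
    refine (abs_add_le _ _).trans (add_le_add ((abs_sub _ _).trans (add_le_add h ?_)) ?_)
    · exact (abs_add_le _ _).trans (add_le_add f1 f3)
    · exact (abs_add_le _ _).trans (add_le_add f2 f4)
  -- the weights `mass U`, `mass V` can be replaced by `a²`, `b²`
  have hratio := mass_ratio_approx hL hLip hU hV ha hb hρ0 hlam k1' k2' k1sq k2sq hC0 (hPC ρ)
    (hQC ρ) (hPC' ρ) (hQC' ρ)
  rw [← hA', ← hB', ← hμ] at hratio
  have hε : 0 < a ^ 2 + b ^ 2 := by positivity
  have hlρ : 0 ≤ lam / ρ := by positivity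
  have e1 : (a ^ 2 * A' + b ^ 2 * B') / (a ^ 2 + b ^ 2) + 2 / 3 * (lam / ρ)
      = (ρ * (A' * mass U + B' * mass V) + 2 / 3 * lam * μ) / (ρ * μ)
        - ((A' * mass U + B' * mass V) * (a ^ 2 + b ^ 2) - (a ^ 2 * A' + b ^ 2 * B') * μ)
          / ((a ^ 2 + b ^ 2) * μ) := by
    field_simp
    ring
  rw [e1]
  refine (abs_sub _ _).trans ?_
  rw [abs_div, abs_div, abs_of_pos (mul_pos hρ0 hμ0), abs_of_pos (mul_pos hε hμ0)]
  have b1 : |ρ * (A' * mass U + B' * mass V) + 2 / 3 * lam * μ| / (ρ * μ)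
      ≤ (2 + 2 * C + 512 * C + 2) * τ * (1 + lam / ρ) := by
    rw [div_le_iff₀ (mul_pos hρ0 hμ0)]
    refine main.trans (le_of_eq ?_)
    field_simp
    ring
  have b2 : |(A' * mass U + B' * mass V) * (a ^ 2 + b ^ 2) - (a ^ 2 * A' + b ^ 2 * B') * μ|
      / ((a ^ 2 + b ^ 2) * μ) ≤ 4 * C ^ 2 * L * (1 / √lam) := by
    rwa [div_le_iff₀ (mul_pos hε hμ0)]
  have b3 : 4 * C ^ 2 * L * (1 / √lam) ≤ 4 * C ^ 2 * L * (τ * (1 + lam / ρ)) := by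
    gcongr
    have h1 : 1 / √lam ≤ 1 / (√lam * δ) :=
      one_div_le_one_div_of_le (by positivity) (mul_le_of_le_one_right hs0.le hδ1)
    have h2 : τ ≤ τ * (1 + lam / ρ) := le_mul_of_one_le_right hτ0 (by linarith only [hlρ])
    linarith only [h1, h2, hτ, hθ, hη, hρi]
  exact (add_le_add b1 (b2.trans b3)).trans (le_of_eq (by ring))

/-! ### Location of the peaks -/

theorem coeff_pos {α β γ : ℝ} (hα : 0 < α) (hγ : 0 < γ)
    (hβ : β ∈ Ioo (-√(α * γ)) 0 ∪ Ioo 0 (min α γ) ∪ Ioi (max α γ)) :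
    0 < (γ - β) / (α * γ - β ^ 2) ∧ 0 < (α - β) / (α * γ - β ^ 2) := by
  rcases hβ with (⟨h1, h2⟩ | ⟨h1, h2⟩) | h1
  · have h3 : (-β) ^ 2 < α * γ := (Real.lt_sqrt (by linarith)).1 (by linarith)
    rw [neg_sq] at h3
    exact ⟨div_pos (by linarith) (by linarith), div_pos (by linarith) (by linarith)⟩
  · obtain ⟨h3, h4⟩ := lt_min_iff.1 h2
    have h5 : β ^ 2 < α * γ := by nlinarith
    exact ⟨div_pos (by linarith) (by linarith), div_pos (by linarith) (by linarith)⟩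
  · obtain ⟨h3, h4⟩ := max_lt_iff.1 (mem_Ioi.1 h1)
    have h5 : α * γ < β ^ 2 := by nlinarith
    exact ⟨div_pos_of_neg_of_neg (by linarith) (by linarith),
      div_pos_of_neg_of_neg (by linarith) (by linarith)⟩

/-- Averages with weights `γ - β` and `α - β` are averages with the squared amplitudes of the two
components as weights. -/
theorem weighted_average_eq {α β γ a b : ℝ} (ha : a ^ 2 = (γ - β) / (α * γ - β ^ 2))
    (hb : b ^ 2 = (α - β) / (α * γ - β ^ 2)) (ha0 : 0 < a) (x y : ℝ) :
    ((γ - β) * x + (α - β) * y) / (α + γ - 2 * β)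
      = (a ^ 2 * x + b ^ 2 * y) / (a ^ 2 + b ^ 2) := by
  have hD : α * γ - β ^ 2 ≠ 0 := by
    intro h
    rw [h, div_zero] at ha
    exact (pow_pos ha0 2).ne' ha
  have e1 : a ^ 2 * x + b ^ 2 * y = ((γ - β) * x + (α - β) * y) / (α * γ - β ^ 2) := by
    rw [ha, hb]; ring
  have e2 : a ^ 2 + b ^ 2 = (α + γ - 2 * β) / (α * γ - β ^ 2) := by
    rw [ha, hb]; ring
  rw [e1, e2, div_div_div_cancel_right₀ hD]

theorem radial_ode {P u v : Plane → ℝ} {α β lam : ℝ} (hu : IsRadial u) (hd : ContDiff ℝ 2 u)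
    (eq : ∀ x, -(Laplacian.laplacian u x) + (lam + P x) * u x
      = α * u x ^ 3 + β * u x * v x ^ 2) {r : ℝ} (hr : 0 < r) :
    deriv (deriv (profile u)) r + deriv (profile u) r / r
      = (lam + profile P r) * profile u r - α * profile u r ^ 3
        - β * profile u r * profile v r ^ 2 := by
  have h := eq (EuclideanSpace.single 0 r)
  rw [hu.laplacian_eq hd hr] at h
  simp only [profile] at h ⊢
  linarith

theorem mass_add_mass_eq {P Q u v : Plane → ℝ} {α β γ lam : ℝ}
    (h : IsRadialSolution P Q α β γ lam u v) :
    2 * Real.pi * (mass (profile u) + mass (profile v)) = 1 := by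
  rw [← h.mass, integral_add h.inH1_u.1.integrable_sq h.inH1_v.1.integrable_sq,
    integral_sq_eq_mass h.radial_u, integral_sq_eq_mass h.radial_v]
  ring

theorem pairNorm_nonneg (P Q : Plane → ℝ) (lam : ℝ) (f g : ℝ → ℝ) : 0 ≤ pairNorm P Q lam f g :=
  Real.sqrt_nonneg _

theorem mass_le_two_mul {f U : ℝ → ℝ} (hf : FiniteEnergy f) (hU : FiniteEnergy U) :
    mass U ≤ 2 * (mass f + mass (fun s => f s - U s)) := by
  have i1 := hf.integrableOn
  have i2 := (hf.sub hU).integrableOn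
  rw [mass, mass, mass, ← integral_add i1 i2, ← integral_const_mul]
  refine setIntegral_mono_on hU.integrableOn ((i1.add i2).const_mul 2) measurableSet_Ioi
    fun r hr => ?_
  have hr0 : (0 : ℝ) < r := hr
  have h : U r ^ 2 ≤ 2 * (f r ^ 2 + (f r - U r) ^ 2) := by nlinarith [sq_nonneg (2 * f r - U r)]
  calc r * U r ^ 2 ≤ r * (2 * (f r ^ 2 + (f r - U r) ^ 2)) := by gcongr
    _ = _ := by ring

/-- The derivative of `M` in terms of the defect in the balance of forces. -/
theorem abs_deriv_M_le {P Q : Plane → ℝ} {α β γ a b lam C ρ : ℝ}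
    (hP : ContDiff ℝ 1 (profile P)) (hQ : ContDiff ℝ 1 (profile Q))
    (hPC : ∀ r, |profile P r| ≤ C) (hQC : ∀ r, |profile Q r| ≤ C)
    (ha : a ^ 2 = (γ - β) / (α * γ - β ^ 2)) (hb : b ^ 2 = (α - β) / (α * γ - β ^ 2))
    (ha0 : 0 < a) (hlam : 1 ≤ lam) (hlamC : 2 * C ≤ lam) (hρ : 0 < ρ) :
    |deriv (M P Q α β γ lam) ρ| ≤ 2 * (C / lam + 3 / 2 * (ρ / lam) *
      |weightedDeriv P Q α β γ ρ / (α + γ - 2 * β) + 2 / 3 * (lam / ρ)|) := by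
  have hlam0 : 0 < lam := by linarith
  set W : ℝ → ℝ := fun r => (γ - β) / (α + γ - 2 * β) * profile P r
    + (α - β) / (α + γ - 2 * β) * profile Q r with hW
  set W' := weightedDeriv P Q α β γ ρ / (α + γ - 2 * β) with hW'
  have hWd : HasDerivAt W W' ρ := by
    have h := ((hP.differentiable (by norm_num) ρ).hasDerivAt.const_mul
      ((γ - β) / (α + γ - 2 * β))).add ((hQ.differentiable (by norm_num) ρ).hasDerivAt.const_mul
      ((α - β) / (α + γ - 2 * β)))
    refine h.congr_deriv ?_
    rw [hW', weightedDeriv]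
    ring
  have hWC : |W ρ| ≤ C := by
    have e : W ρ = (a ^ 2 * profile P ρ + b ^ 2 * profile Q ρ) / (a ^ 2 + b ^ 2) := by
      rw [← weighted_average_eq ha hb ha0]
      simp only [hW]
      ring
    have hε : 0 < a ^ 2 + b ^ 2 := by positivity
    rw [e, abs_div, abs_of_pos hε, div_le_iff₀ hε]
    refine (abs_add_le _ _).trans ?_
    rw [abs_mul, abs_mul, abs_of_nonneg (sq_nonneg a), abs_of_nonneg (sq_nonneg b), mul_add,
      mul_comm C, mul_comm C]
    gcongr
    · exact hPC ρ
    · exact hQC ρ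
  have hX := abs_le.1 hWC
  have hWl : |W ρ / lam| ≤ 1 / 2 := by
    rw [abs_div, abs_of_pos hlam0, div_le_iff₀ hlam0]
    linarith
  have hWl' := abs_le.1 hWl
  set X := 1 + 1 / lam * W ρ with hXdef
  have hXe : X = 1 + W ρ / lam := by rw [hXdef]; ring
  have hX0 : 0 < X := by rw [hXe]; linarith
  have hX2 : X ≤ 2 := by rw [hXe]; linarith
  have hM : HasDerivAt (M P Q α β γ lam)
      (X ^ (1 / 2 : ℝ) * (W ρ / lam + 3 / 2 * (ρ / lam) * (W' + 2 / 3 * (lam / ρ)))) ρ := by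
    have h := (hasDerivAt_id ρ).mul (((hWd.const_mul (1 / lam)).const_add 1).rpow_const
      (p := 3 / 2) (Or.inl hX0.ne'))
    refine h.congr_deriv ?_
    have e1 : (3 / 2 : ℝ) - 1 = 1 / 2 := by norm_num
    have e2 : X ^ (3 / 2 : ℝ) = X * X ^ (1 / 2 : ℝ) := by
      rw [show (3 / 2 : ℝ) = 1 + 1 / 2 by norm_num, Real.rpow_add hX0, Real.rpow_one]
    simp only [id]
    rw [e1, ← hXdef, e2, hXdef]
    field_simp
    ring
  have hsq : X ^ (1 / 2 : ℝ) ≤ 2 := by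
    rw [← Real.sqrt_eq_rpow, Real.sqrt_le_left (by norm_num)]
    linarith
  rw [hM.deriv, abs_mul, abs_of_nonneg (Real.rpow_nonneg hX0.le _)]
  have hin : |W ρ / lam + 3 / 2 * (ρ / lam) * (W' + 2 / 3 * (lam / ρ))|
      ≤ C / lam + 3 / 2 * (ρ / lam) * |W' + 2 / 3 * (lam / ρ)| := by
    refine (abs_add_le _ _).trans (add_le_add ?_ (le_of_eq ?_))
    · rw [abs_div, abs_of_pos hlam0]
      gcongr
    · rw [abs_mul, abs_of_nonneg (by positivity)]
  exact mul_le_mul hsq hin (abs_nonneg _) (by norm_num)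

end BEC

theorem theorem1p1
    (P Q : BEC.Plane → ℝ)
    (hP : BEC.IsAdmissiblePotential P) (hQ : BEC.IsAdmissiblePotential Q)
    (α β γ lam r : ℕ → ℝ) (u v : ℕ → BEC.Plane → ℝ)
    (hα : ∀ n, 0 < α n) (hγ : ∀ n, 0 < γ n)
    (hβ : ∀ n, β n ∈ Set.Ioo (-√(α n * γ n)) 0 ∪ Set.Ioo 0 (min (α n) (γ n))
      ∪ Set.Ioi (max (α n) (γ n)))
    (hlam : Filter.Tendsto lam Filter.atTop Filter.atTop)
    (hr : ∀ n, 0 ≤ r n)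
    (hsol : ∀ n, BEC.IsRadialSolution P Q (α n) (β n) (γ n) (lam n) (u n) (v n))
    (herr : (fun n => BEC.pairNorm P Q (lam n)
          (fun s => BEC.profile (u n) s - BEC.peakU P (α n) (β n) (γ n) (lam n) (r n) s)
          (fun s => BEC.profile (v n) s - BEC.peakV Q (α n) (β n) (γ n) (lam n) (r n) s))
        =o[Filter.atTop]
        (fun n => BEC.pairNorm P Q (lam n)
          (BEC.peakU P (α n) (β n) (γ n) (lam n) (r n))
          (BEC.peakV Q (α n) (β n) (γ n) (lam n) (r n)))) :
    -- `ε → 0` and `r → ∞`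
    Filter.Tendsto (fun n => BEC.eps (α n) (β n) (γ n)) Filter.atTop (nhds 0) ∧
    Filter.Tendsto r Filter.atTop Filter.atTop ∧
    -- the alternative
    (UniformContinuous (deriv (BEC.profile P)) → UniformContinuous (deriv (BEC.profile Q)) →
      -- `M'(r)` is small or the normalized weighted derivative is small
      Filter.Tendsto (fun n => min
          |deriv (BEC.M P Q (α n) (β n) (γ n) (lam n)) (r n)|
          |BEC.weightedDeriv P Q (α n) (β n) (γ n) (r n) / (α n + γ n - 2 * β n)|)
        Filter.atTop (nhds 0) ∧
      -- the first case occurs when `r / lam` is bounded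
      ((∃ C : ℝ, ∀ᶠ n in Filter.atTop, r n / lam n ≤ C) →
        Filter.Tendsto (fun n => deriv (BEC.M P Q (α n) (β n) (γ n) (lam n)) (r n))
          Filter.atTop (nhds 0)) ∧
      -- the second case occurs when `r / lam → ∞`
      (Filter.Tendsto (fun n => r n / lam n) Filter.atTop Filter.atTop →
        (fun n => BEC.weightedDeriv P Q (α n) (β n) (γ n) (r n))
          =o[Filter.atTop] (fun n => α n + γ n - 2 * β n))) := by
  obtain ⟨C₁, hC₁⟩ := hP.bounded
  obtain ⟨C₂, hC₂⟩ := hQ.bounded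
  obtain ⟨C₃, hC₃⟩ := hP.deriv_bounded
  obtain ⟨C₄, hC₄⟩ := hQ.deriv_bounded
  obtain ⟨C, c1, c2, c3, c4⟩ : ∃ C, C₁ ≤ C ∧ C₂ ≤ C ∧ C₃ ≤ C ∧ C₄ ≤ C :=
    ⟨max (max C₁ C₂) (max C₃ C₄), by simp⟩
  have hPC (s : ℝ) : |BEC.profile P s| ≤ C := (hC₁ _).trans c1
  have hQC (s : ℝ) : |BEC.profile Q s| ≤ C := (hC₂ _).trans c2
  have hPC' (s : ℝ) : |deriv (BEC.profile P) s| ≤ C := (hC₃ s).trans c3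
  have hQC' (s : ℝ) : |deriv (BEC.profile Q) s| ≤ C := (hC₄ s).trans c4
  have hC0 : 0 ≤ C := (abs_nonneg _).trans (hPC 0)
  have hPd : ContDiff ℝ 1 (BEC.profile P) := BEC.contDiff_profile hP.contDiff
  have hQd : ContDiff ℝ 1 (BEC.profile Q) := BEC.contDiff_profile hQ.contDiff
  -- amplitudes of the two components
  set a : ℕ → ℝ := fun n => √((γ n - β n) / (α n * γ n - β n ^ 2))
  set b : ℕ → ℝ := fun n => √((α n - β n) / (α n * γ n - β n ^ 2))
  have hco (n : ℕ) := BEC.coeff_pos (hα n) (hγ n) (hβ n)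
  have ha (n : ℕ) : 0 < a n := Real.sqrt_pos.2 (hco n).1
  have hb (n : ℕ) : 0 < b n := Real.sqrt_pos.2 (hco n).2
  have ha2 (n : ℕ) : a n ^ 2 = (γ n - β n) / (α n * γ n - β n ^ 2) := Real.sq_sqrt (hco n).1.le
  have hb2 (n : ℕ) : b n ^ 2 = (α n - β n) / (α n * γ n - β n ^ 2) := Real.sq_sqrt (hco n).2.le
  have heps (n : ℕ) : BEC.eps (α n) (β n) (γ n) = a n ^ 2 + b n ^ 2 := by
    rw [ha2, hb2, BEC.eps]; ring
  have hden (n : ℕ) : α n + γ n - 2 * β n ≠ 0 := by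
    intro h
    have h1 : 0 < BEC.eps (α n) (β n) (γ n) := by
      have := ha n
      rw [heps]
      positivity
    rw [BEC.eps, h, zero_div] at h1
    exact lt_irrefl _ h1
  set U : ℕ → ℝ → ℝ := fun n => BEC.peakU P (α n) (β n) (γ n) (lam n) (r n)
  set V : ℕ → ℝ → ℝ := fun n => BEC.peakV Q (α n) (β n) (γ n) (lam n) (r n)
  have hU (n : ℕ) : U n = BEC.peak (a n) (√(lam n + BEC.profile P (r n))) (r n) := rfl
  have hV (n : ℕ) : V n = BEC.peak (b n) (√(lam n + BEC.profile Q (r n))) (r n) := rfl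
  have hp2 (n : ℕ) : ContDiff ℝ 2 (BEC.profile (u n)) := BEC.contDiff_profile (hsol n).contDiff_u
  have hq2 (n : ℕ) : ContDiff ℝ 2 (BEC.profile (v n)) := BEC.contDiff_profile (hsol n).contDiff_v
  have hp (n : ℕ) : BEC.FiniteEnergy (BEC.profile (u n)) := BEC.finiteEnergy_profile
    (hsol n).radial_u ((hsol n).contDiff_u.of_le (by norm_num)) (hsol n).inH1_u
  have hq (n : ℕ) : BEC.FiniteEnergy (BEC.profile (v n)) := BEC.finiteEnergy_profile
    (hsol n).radial_v ((hsol n).contDiff_v.of_le (by norm_num)) (hsol n).inH1_v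
  have eqp (n : ℕ) (s : ℝ) (hs : 0 < s) := BEC.radial_ode (hsol n).radial_u (hsol n).contDiff_u
    (hsol n).eq_u hs
  have eqq (n : ℕ) (s : ℝ) (hs : 0 < s) :
      deriv (deriv (BEC.profile (v n))) s + deriv (BEC.profile (v n)) s / s
      = (lam n + BEC.profile Q s) * BEC.profile (v n) s - γ n * BEC.profile (v n) s ^ 3
        - β n * BEC.profile (u n) s ^ 2 * BEC.profile (v n) s := by
    have h := BEC.radial_ode (v := u n) (β := β n) (hsol n).radial_v (hsol n).contDiff_v
      (fun x => ((hsol n).eq_v x).trans (by ring)) hs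
    linarith
  have hlam1 : ∀ᶠ n in atTop, 1 ≤ lam n := hlam.eventually_ge_atTop 1
  have hlamC : ∀ᶠ n in atTop, 8 * C ≤ lam n := hlam.eventually_ge_atTop _
  have hsqrt : Tendsto (fun n => 1 / √(lam n)) atTop (𝓝 0) :=
    tendsto_const_nhds.div_atTop (Real.tendsto_sqrt_atTop.comp hlam)
  have herr' {η : ℝ} (hη : 0 < η) : ∀ᶠ n in atTop,
      BEC.pairNorm P Q (lam n) (fun s => BEC.profile (u n) s - U n s)
        (fun s => BEC.profile (v n) s - V n s) ≤ η * BEC.pairNorm P Q (lam n) (U n) (V n) := by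
    filter_upwards [herr.def hη] with n hn
    rwa [Real.norm_eq_abs, Real.norm_eq_abs, abs_of_nonneg (BEC.pairNorm_nonneg _ _ _ _ _),
      abs_of_nonneg (BEC.pairNorm_nonneg _ _ _ _ _)] at hn
  -- the Pohozaev identity on the peaks holds up to a vanishing relative error
  obtain ⟨K₁, hK₁, hpoh⟩ := BEC.pohozaev_peaks C
  have hest {θ : ℝ} (hθ : 0 < θ) : ∀ᶠ n in atTop,
      |((∫ s in Ioi (0 : ℝ), s * BEC.virialForm (BEC.profile P) (max 1 (r n)) (U n) s)
        + ∫ s in Ioi (0 : ℝ), s * BEC.virialForm (BEC.profile Q) (max 1 (r n)) (V n) s)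
      - ((BEC.mass (deriv (U n)) - lam n * BEC.mass (U n))
        + (BEC.mass (deriv (V n)) - lam n * BEC.mass (V n)))|
      ≤ θ * (lam n + max 1 (r n)) * (BEC.mass (U n) + BEC.mass (V n)) := by
    set η := min 1 (θ / (2 * (K₁ + 1)))
    have hη0 : 0 < η := lt_min one_pos (by positivity)
    filter_upwards [herr' hη0, hlam1, hlamC,
      hsqrt.eventually_le_const (show (0 : ℝ) < θ / (2 * (K₁ + 1)) by positivity)]
      with n h1 h2 h3 h4
    refine (hpoh hPd hQd hPC hQC hPC' hQC' (hp2 n) (hq2 n) (hp n) (hq n) (eqp n) (eqq n) (hr n) h2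
      (by linarith) (hU n) (hV n) hη0 (min_le_left _ _) h1).trans ?_
    have hm1 := BEC.mass_nonneg (U n)
    have hm2 := BEC.mass_nonneg (V n)
    gcongr
    have h5 : η ≤ θ / (2 * (K₁ + 1)) := min_le_right _ _
    calc K₁ * (η + 1 / √(lam n)) ≤ (K₁ + 1) * (θ / (2 * (K₁ + 1)) + θ / (2 * (K₁ + 1))) := by
          gcongr; linarith
      _ = θ := by field_simp; norm_num
  have hfar : ∀ᶠ n in atTop, 1 ≤ r n ∧ lam n ≤ (24 * C + 1) * r n := by
    filter_upwards [hest (show (0 : ℝ) < 1 / 8 by norm_num), hlam1, hlamC,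
      hlam.eventually_gt_atTop (24 * C + 1)] with n h1 h2 h3 h4
    have h5 := BEC.lam_le_of_pohozaev hPd hQd hPC hQC hPC' hQC' (ha n) (hr n) h2 h3 (hU n) (hV n)
      le_rfl h1
    rcases le_total (r n) 1 with h6 | h6
    · rw [max_eq_left h6] at h5
      linarith
    · rw [max_eq_right h6] at h5
      exact ⟨h6, h5⟩
  have hr_top : Tendsto r atTop atTop := by
    refine tendsto_atTop_mono' _ ?_ (hlam.atTop_div_const (show (0 : ℝ) < 24 * C + 1 by linarith))
    filter_upwards [hfar] with n hn
    rw [div_le_iff₀ (by linarith)]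
    linarith [hn.2]
  have hri : Tendsto (fun n => 1 / r n) atTop (𝓝 0) := tendsto_const_nhds.div_atTop hr_top
  -- the peaks carry mass at least `ε r`, and the total mass of the solution is normalized
  have heps0 : Tendsto (fun n => BEC.eps (α n) (β n) (γ n)) atTop (𝓝 0) := by
    refine squeeze_zero' (Eventually.of_forall fun n => by rw [heps]; positivity) ?_ hri
    filter_upwards [herr' (show (0 : ℝ) < 1 / 8 by norm_num), hlam1, hlamC, hfar]
      with n h1 h2 h3 ⟨h4, _⟩
    have hlam0 : 0 < lam n := by linarith
    have hs1 : 1 ≤ √(lam n) := Real.one_le_sqrt.2 h2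
    have k1 := BEC.half_sqrt_le_sqrt_add hlam0.le (by linarith) (hPC (r n))
    have k2 := BEC.half_sqrt_le_sqrt_add hlam0.le (by linarith) (hQC (r n))
    have g1 := BEC.le_mass_peak (a n) (show 0 < √(lam n + BEC.profile P (r n)) by linarith) (hr n)
    have g2 := BEC.le_mass_peak (b n) (show 0 < √(lam n + BEC.profile Q (r n)) by linarith) (hr n)
    have hUe : BEC.FiniteEnergy (U n) := BEC.finiteEnergy_peak (a n)
      (show 0 < √(lam n + BEC.profile P (r n)) by linarith) (hr n)
    have hVe : BEC.FiniteEnergy (V n) := BEC.finiteEnergy_peak (b n)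
      (show 0 < √(lam n + BEC.profile Q (r n)) by linarith) (hr n)
    rw [← hU] at g1
    rw [← hV] at g2
    have e1 := BEC.energy_error_le hPd.continuous hQd.continuous hPC hQC (hp n) (hq n) (hr n) h2
      (by linarith) (hU n) (hV n) (by norm_num) h1
    have e2 : BEC.mass (fun s => BEC.profile (u n) s - U n s)
        + BEC.mass (fun s => BEC.profile (v n) s - V n s)
        ≤ 12 * (1 / 8) ^ 2 * (BEC.mass (U n) + BEC.mass (V n)) := by
      have t1 := BEC.mass_nonneg (deriv fun s => BEC.profile (u n) s - U n s)
      have t2 := BEC.mass_nonneg (deriv fun s => BEC.profile (v n) s - V n s)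
      rw [BEC.energy, BEC.energy] at e1
      refine le_of_mul_le_mul_left ?_ hlam0
      linarith
    have m1 := BEC.mass_le_two_mul (hp n) hUe
    have m2 := BEC.mass_le_two_mul (hq n) hVe
    have m3 := BEC.mass_add_mass_eq (hsol n)
    have m4 : BEC.mass (BEC.profile (u n)) + BEC.mass (BEC.profile (v n)) ≤ 1 / 6 := by
      have := BEC.mass_nonneg (BEC.profile (u n))
      have := BEC.mass_nonneg (BEC.profile (v n))
      nlinarith [Real.pi_gt_three]
    have hμ : BEC.mass (U n) + BEC.mass (V n) ≤ 1 := by linarith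
    have g3 : r n ≤ 1 + 2 * (√(lam n + BEC.profile P (r n)) * r n) := by nlinarith
    have g4 : r n ≤ 1 + 2 * (√(lam n + BEC.profile Q (r n)) * r n) := by nlinarith
    have g5 := mul_le_mul_of_nonneg_left g3 (sq_nonneg (a n))
    have g6 := mul_le_mul_of_nonneg_left g4 (sq_nonneg (b n))
    rw [heps, le_div_iff₀ (by linarith)]
    linarith
  refine ⟨heps0, hr_top, fun hPu hQu => ?_⟩
  -- the defect `d` in the balance of forces vanishes in the limit
  obtain ⟨K₂, hK₂, hbal⟩ := BEC.balance_of_pohozaev C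
  set d : ℕ → ℝ := fun n => BEC.weightedDeriv P Q (α n) (β n) (γ n) (r n) / (α n + γ n - 2 * β n)
    + 2 / 3 * (lam n / r n) with hd_def
  have hd : Tendsto d atTop (𝓝 0) := by
    refine (tendsto_zero_iff_abs_tendsto_zero _).2 (tendsto_order.2
      ⟨fun x hx => Eventually.of_forall fun n => hx.trans_le (abs_nonneg _), fun x hx => ?_⟩)
    set σ := x / (8 * (K₂ + 1) * (24 * C + 2)) with hσ_def
    have hσ : 0 < σ := by positivity
    obtain ⟨δ₁, hδ₁, hu₁⟩ := Metric.uniformContinuous_iff.1 hPu σ hσ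
    obtain ⟨δ₂, hδ₂, hu₂⟩ := Metric.uniformContinuous_iff.1 hQu σ hσ
    set δ := min 1 (min δ₁ δ₂)
    have hδ : 0 < δ := lt_min one_pos (lt_min hδ₁ hδ₂)
    have hsδ : Tendsto (fun n => 1 / (√(lam n) * δ)) atTop (𝓝 0) := by
      have h := hsqrt.mul_const (1 / δ)
      rw [zero_mul] at h
      exact h.congr fun n => by rw [div_mul_div_comm, one_mul]
    filter_upwards [hest hσ, hlam1, hlamC, hfar, hri.eventually_le_const hσ,
      hsδ.eventually_le_const hσ] with n h1 h2 h3 ⟨h4, h5⟩ h6 h7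
    have h8 := hbal hPd hQd hPC hQC hPC' hQC' (ha n) (hb n) h4 h2 (by linarith) (hU n) (hV n)
      hσ.le hσ.le hδ (min_le_left _ _)
      (fun s hs => (hu₁ (hs.trans_le ((min_le_right _ _).trans (min_le_left _ _)))).le)
      (fun s hs => (hu₂ (hs.trans_le ((min_le_right _ _).trans (min_le_right _ _)))).le) h1
    have hr0 : 0 < r n := by linarith
    have h9 : 1 + lam n / r n ≤ 24 * C + 2 := by
      have : lam n / r n ≤ 24 * C + 1 := (div_le_iff₀ hr0).2 h5
      linarith
    have h10 : 0 ≤ lam n / r n := div_nonneg (by linarith) hr0.le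
    have e : d n = (a n ^ 2 * deriv (BEC.profile P) (r n) + b n ^ 2 * deriv (BEC.profile Q) (r n))
        / (a n ^ 2 + b n ^ 2) + 2 / 3 * (lam n / r n) := by
      simp only [hd_def, BEC.weightedDeriv]
      rw [BEC.weighted_average_eq (ha2 n) (hb2 n) (ha n)]
    change |d n| < x
    rw [e]
    calc _ ≤ K₂ * (σ + σ + 1 / r n + 1 / (√(lam n) * δ)) * (1 + lam n / r n) := h8
      _ ≤ (K₂ + 1) * (σ + σ + σ + σ) * (24 * C + 2) := by
          gcongr
          linarith
      _ = x / 2 := by rw [hσ_def]; field_simp; ring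
      _ < x := half_lt_self hx
  have hM : ∀ᶠ n in atTop, |deriv (BEC.M P Q (α n) (β n) (γ n) (lam n)) (r n)|
      ≤ 2 * (C / lam n + 3 / 2 * (r n / lam n) * |d n|) := by
    filter_upwards [hlam1, hlamC, hfar] with n h1 h2 h3
    exact BEC.abs_deriv_M_le hPd hQd hPC hQC (ha2 n) (hb2 n) (ha n) h1 (by linarith)
      (by linarith [h3.1])
  have hd' : Tendsto (fun n => |d n|) atTop (𝓝 0) := by simpa using hd.abs
  have hCl : Tendsto (fun n => C / lam n) atTop (𝓝 0) := tendsto_const_nhds.div_atTop hlam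
  -- where `r / lam ≤ T`, the derivative of `M` is small
  have hT (T : ℝ) : Tendsto (fun n => 2 * (C / lam n + 3 / 2 * T * |d n|)) atTop (𝓝 0) := by
    simpa using (hCl.add (hd'.const_mul (3 / 2 * T))).const_mul 2
  have hMT (T : ℝ) : ∀ᶠ n in atTop, r n / lam n ≤ T →
      |deriv (BEC.M P Q (α n) (β n) (γ n) (lam n)) (r n)|
        ≤ 2 * (C / lam n + 3 / 2 * T * |d n|) := by
    filter_upwards [hM] with n hn hle
    refine hn.trans ?_
    gcongr
  -- elsewhere the curvature term `lam / r` of `d` is small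
  have hW {n : ℕ} {T : ℝ} (hT : 0 < T) (hl : 0 < lam n) (h : T ≤ r n / lam n) :
      |BEC.weightedDeriv P Q (α n) (β n) (γ n) (r n) / (α n + γ n - 2 * β n)|
        ≤ |d n| + 1 / T := by
    have h1 : 0 ≤ lam n / r n := div_nonneg hl.le (hr n)
    have h2 : lam n / r n ≤ 1 / T := by
      rw [← inv_div, ← one_div]
      exact one_div_le_one_div_of_le hT h
    have h3 : BEC.weightedDeriv P Q (α n) (β n) (γ n) (r n) / (α n + γ n - 2 * β n)
        = d n - 2 / 3 * (lam n / r n) := by simp only [hd_def]; ring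
    rw [h3]
    refine (abs_sub _ _).trans ?_
    rw [abs_of_nonneg (show 0 ≤ 2 / 3 * (lam n / r n) by positivity)]
    linarith
  refine ⟨?_, ?_, ?_⟩
  · refine tendsto_order.2 ⟨fun x hx => Eventually.of_forall fun n =>
      hx.trans_le (le_min (abs_nonneg _) (abs_nonneg _)), fun x hx => ?_⟩
    filter_upwards [hMT (2 / x), (hT (2 / x)).eventually_lt_const hx,
      hd'.eventually_lt_const (half_pos hx), hlam1] with n h1 h2 h3 h4
    rcases le_total (r n / lam n) (2 / x) with h5 | h5
    · exact (min_le_left _ _).trans_lt ((h1 h5).trans_lt h2)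
    · refine (min_le_right _ _).trans_lt ((hW (by positivity) (by linarith) h5).trans_lt ?_)
      rw [one_div_div]
      linarith
  · rintro ⟨T, hTb⟩
    refine squeeze_zero_norm' ?_ (hT T)
    filter_upwards [hMT T, hTb] with n h1 h2
    exact h1 h2
  · intro htop
    refine (Asymptotics.isLittleO_iff_tendsto fun n h => absurd h (hden n)).2 ?_
    refine (tendsto_zero_iff_abs_tendsto_zero _).2 (tendsto_order.2
      ⟨fun x hx => Eventually.of_forall fun n => hx.trans_le (abs_nonneg _), fun x hx => ?_⟩)
    filter_upwards [htop.eventually_ge_atTop (2 / x), hd'.eventually_lt_const (half_pos hx), hlam1]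
      with n h1 h2 h3
    refine (hW (by positivity) (by linarith) h1).trans_lt ?_
    rw [one_div_div]
    linarith

end
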